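/- Let $\Phi$ be a finite, reduced, irreducible crystallographic root system with simple roots $\alpha_1,\dots,\alpha_n$ and highest root $\xi$. Let $V$ be the real vector space spanned by the coroots, on which the roots act as linear forms, written $\langle\alpha,x\rangle$ for $x\in V$. Let $W$ be the Weyl group acting on $V$, let $Q^\vee\subset V$ be the coroot lattice, and let $\tilde W$ be the affine Weyl group, i.e. the group of affine transformations of $V$ generated by the reflections $x\mapsto x-(\langle\alpha,x\rangle-k)\alpha^\vee$ ($\alpha\in\Phi$, $k\in\mathbb Z$). Its simple reflections are the reflections $s_i$ in the hyperplanes $\langle\alpha_i,x\rangle=0$ ($1\le i\le n$) and the reflection $s_0$ in $\langle\xi,x\rangle=1$. For $\lambda\in Q^\vee$ let $t_\lambda\in\tilde W$ be the translation by $\lambda$. An infinite word $\mathbf i=i_1i_2\cdots$ in the indices $0,\dots,n$ is an infinite reduced word if all its prefixes $s_{i_1}\cdots s_{i_k}$ are reduced. Its inversion set consists of the reflections $s_{i_1}\cdots s_{i_{a-1}}s_{i_a}s_{i_{a-1}}\cdots s_{i_1}$, $a\ge1$, and $[\mathbf i]$ denotes the class of all infinite reduced words with the same inversion set as $\mathbf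 i$. An element $w\in\tilde W$ is fully commutative if no reduced word for $w$ contains as a consecutive subword an alternating word $s_is_js_i\cdots$ whose length is the order $m_{ij}$ of $s_is_j$, with $3\le m_{ij}<\infty$. An infinite reduced word is fully commutative if all its finite prefixes represent fully commutative elements, and a class $[\mathbf i]$ is fully commutative if the infinite reduced words in it are. For $\lambda\neq0$, $[t_\lambda^\infty]$ is the class of the infinite word obtained by repeating a reduced word for $t_\lambda$ indefinitely; for $\lambda=0$ this is undefined, and "$[t_0^\infty]$ is fully commutative" is taken to be false. Let $\lambda\in Q^\vee$ and $w\in W$. Then $[t_\lambda^\infty]$ is fully commutative if and only if $[t_{w\lambda}^\infty]$ is fully commutative. (In particular, $[t_\lambda^\infty]$ is fully commutative if and only if $[t_{w\lambda}^\infty]$ is fully commutative for every $w\in W$.) -/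

import Mathlib

/-! Words in a family of generators of a group: reduced words, inversions, infinite reduced words,
limit elements and full commutativity. -/

namespace LimitWeak

section Words

variable {B G : Type*} [Group G] (s : B → G)

/-- The product `s_{i_1} ⋯ s_{i_l}` of a finite word. -/
def wordProd (L : List B) : G := (L.map s).prod

/-- `L` is a reduced word: it has minimal length among the words with the same product. -/
def IsReducedWord (L : List B) : Prop :=
  ∀ L' : List B, wordProd s L' = wordProd s L → L.length ≤ L'.length

/-- The inversions of a finite word, as reflections:
`s_{i_1} ⋯ s_{i_{a-1}} s_{i_a} s_{i_{a-1}} ⋯ s_{i_1}` for each position `a`. -/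
def inversions (L : List B) : Set G :=
  {t | ∃ (a : ℕ) (h : a < L.length),
    t = wordProd s (L.take a) * s L[a] * (wordProd s (L.take a))⁻¹}

/-- An element is fully commutative if no reduced word for it contains as a factor an alternating
word `s_i s_j s_i ⋯` of length `m`, where `m ≥ 3` is the (finite) order of `s_i s_j`, that is, if
no braid move can be applied to any of its reduced words. (`orderOf` is `0` for infinite order.) -/
def IsFullyCommutativeElt (w : G) : Prop :=
  ∀ L : List B, IsReducedWord s L → wordProd s L = w →
    ∀ i j : B, 3 ≤ orderOf (s i * s j) →
      ¬ CoxeterSystem.alternatingWord i j (orderOf (s i * s j)) <:+: L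

/-- The prefix of length `k` of an infinite word. -/
def initialWord (a : ℕ → B) (k : ℕ) : List B := (List.range k).map a

/-- Infinite words all of whose finite prefixes are reduced. -/
structure InfiniteReducedWord where
  letter : ℕ → B
  reduced : ∀ k, IsReducedWord s (initialWord letter k)

namespace InfiniteReducedWord

variable {s}

/-- The inversion set of an infinite reduced word, the union of those of its prefixes. -/
def inv (a : InfiniteReducedWord s) : Set G :=
  ⋃ k : ℕ, inversions s (initialWord a.letter k)

/-- An infinite reduced word is fully commutative if the products of all its prefixes are. -/
def IsFullyCommutative (a : InfiniteReducedWord s) : Prop :=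
  ∀ k, IsFullyCommutativeElt s (wordProd s (initialWord a.letter k))

/-- Two infinite reduced words are equivalent if they have the same inversion set. -/
instance setoid : Setoid (InfiniteReducedWord s) := Setoid.ker inv

end InfiniteReducedWord

/-- Limit elements `[a]`: classes of infinite reduced words with the same inversion set. -/
def LimitElement := Quotient (InfiniteReducedWord.setoid (s := s))

variable {s}

/-- The class `[a]` of an infinite reduced word. -/
def InfiniteReducedWord.cls (a : InfiniteReducedWord s) : LimitElement s := Quotient.mk _ a

/-- A limit element is fully commutative if the infinite reduced words in it are. -/
def LimitElement.IsFullyCommutative (x : LimitElement s) : Prop :=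
  ∀ a : InfiniteReducedWord s, a.cls = x → a.IsFullyCommutative

/-- `x = [t^∞]`: the limit element `x` is the class of the infinite reduced word `L L L ⋯`, where
`L` is a (nonempty) reduced word for `t`. -/
def LimitElement.IsInfinitePower (x : LimitElement s) (t : G) : Prop :=
  ∃ (L : List B) (hL : 0 < L.length) (a : InfiniteReducedWord s),
    IsReducedWord s L ∧ wordProd s L = t ∧
      (∀ k, a.letter k = L[k % L.length]'(Nat.mod_lt k hL)) ∧ a.cls = x

variable (s)

/-- `[t^∞]` is (defined and) fully commutative. -/
def InfinitePowerIsFullyCommutative (t : G) : Prop :=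
  ∃ x : LimitElement s, x.IsInfinitePower t ∧ x.IsFullyCommutative

end Words

/-! The affine Weyl group of a finite crystallographic root system, acting on the space `N` that
contains the coroots. -/

section AffineWeyl

variable {ι M N : Type*} [AddCommGroup M] [Module ℝ M] [AddCommGroup N] [Module ℝ N]
  (P : RootPairing ι ℝ M N)

/-- The finite Weyl group, acting linearly on `N`. -/
def weylGroup : Subgroup (N ≃ₗ[ℝ] N) := Subgroup.closure (Set.range P.coreflection)

/-- The reflection `x ↦ x - (⟨α_i, x⟩ - k) α_i^∨` in the hyperplane `⟨α_i, x⟩ = k`. -/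
def affineReflection (i : ι) (k : ℤ) : N ≃ᵃ[ℝ] N :=
  AffineEquiv.constVAdd ℝ N ((k : ℝ) • P.coroot i) * (P.coreflection i).toAffineEquiv

theorem affineReflection_apply (i : ι) (k : ℤ) (x : N) :
    affineReflection P i k x = x - (P.root' i x - k) • P.coroot i := by
  simp [affineReflection, AffineEquiv.mul_def, RootPairing.coreflection_apply, sub_smul]
  abel

/-- The affine Weyl group, generated by the reflections in all the hyperplanes `⟨α, x⟩ = k`,
with `α` a root and `k` an integer. -/
def affineWeylGroup : Subgroup (N ≃ᵃ[ℝ] N) :=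
  Subgroup.closure {g | ∃ (i : ι) (k : ℤ), g = affineReflection P i k}

theorem affineReflection_mem (i : ι) (k : ℤ) : affineReflection P i k ∈ affineWeylGroup P :=
  Subgroup.subset_closure ⟨i, k, rfl⟩

theorem constVAdd_mem_affineWeylGroup (l : P.corootSpan ℤ) :
    AffineEquiv.constVAdd ℝ N (l : N) ∈ affineWeylGroup P := by
  obtain ⟨l, hl⟩ := l
  induction hl using Submodule.span_induction with
  | mem x hx =>
    obtain ⟨i, rfl⟩ := hx
    have h : AffineEquiv.constVAdd ℝ N (P.coroot i) =
        affineReflection P i 1 * (affineReflection P i 0)⁻¹ := by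
      rw [eq_mul_inv_iff_mul_eq]
      ext x
      simp [affineReflection, AffineEquiv.mul_def]
    simp only [h]
    exact mul_mem (affineReflection_mem P i 1) (inv_mem (affineReflection_mem P i 0))
  | zero =>
    simp only [AffineEquiv.constVAdd_zero]
    exact one_mem (affineWeylGroup P)
  | add x y _ _ hx hy =>
    have h : AffineEquiv.constVAdd ℝ N (x + y) =
        AffineEquiv.constVAdd ℝ N x * AffineEquiv.constVAdd ℝ N y :=
      (AffineEquiv.constVAddHom ℝ N).map_mul (.ofAdd x) (.ofAdd y)
    simp only [h]
    exact mul_mem hx hy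
  | smul c x _ hx =>
    have h : AffineEquiv.constVAdd ℝ N (c • x) = AffineEquiv.constVAdd ℝ N x ^ c :=
      AffineEquiv.constVAdd_zsmul (k := ℝ) (P₁ := N) c x
    simp only [h]
    exact zpow_mem hx c

/-- The element `t_l` of the affine Weyl group that acts as translation by the element `l` of the
coroot lattice. -/
def translation (l : P.corootSpan ℤ) : affineWeylGroup P :=
  ⟨AffineEquiv.constVAdd ℝ N (l : N), constVAdd_mem_affineWeylGroup P l⟩

theorem translation_apply (l : P.corootSpan ℤ) (x : N) :
    (translation P l : N ≃ᵃ[ℝ] N) x = l + x := rfl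

theorem weylGroup_apply_mem (w : weylGroup P) (l : P.corootSpan ℤ) :
    (w : N ≃ₗ[ℝ] N) (l : N) ∈ P.corootSpan ℤ := by
  have key : ∀ g ∈ weylGroup P, ∀ x ∈ P.corootSpan ℤ,
      g x ∈ P.corootSpan ℤ ∧ g⁻¹ x ∈ P.corootSpan ℤ := by
    intro g hg
    induction hg using Subgroup.closure_induction with
    | mem g hg =>
      obtain ⟨i, rfl⟩ := hg
      intro x hx
      rw [P.coreflection_inv, and_self]
      induction hx using Submodule.span_induction with
      | mem x hx =>
        obtain ⟨j, rfl⟩ := hx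
        rw [← P.coroot_reflectionPerm]
        exact Submodule.subset_span (Set.mem_range_self _)
      | zero => simp
      | add x y _ _ hx hy => simpa using add_mem hx hy
      | smul c x _ hx => simpa using Submodule.smul_mem _ c hx
    | one => exact fun x hx => ⟨hx, by simpa using hx⟩
    | mul g h _ _ hg hh =>
      intro x hx
      rw [mul_inv_rev]
      exact ⟨(hg _ (hh x hx).1).1, (hh _ (hg x hx).2).2⟩
    | inv g _ hg => exact fun x hx => ⟨(hg x hx).2, by simpa using (hg x hx).1⟩
  exact (key w w.2 l l.2).1

/-- The action of the finite Weyl group on the coroot lattice. -/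
def weylAct (w : weylGroup P) (l : P.corootSpan ℤ) : P.corootSpan ℤ :=
  ⟨(w : N ≃ₗ[ℝ] N) (l : N), weylGroup_apply_mem P w l⟩

variable {P}

/-- `ξ` is (the index of) the highest root with respect to the base `b`: for every root `β`, the
difference `ξ - β` is a sum of simple roots. -/
def IsHighestRoot (b : P.Base) (ξ : ι) : Prop :=
  ∀ i, P.root ξ - P.root i ∈ AddSubmonoid.closure (P.root '' b.support)

/-- The simple reflections of the affine Weyl group: `s_i` for the simple roots `α_i`, and the
affine one `s_0`, the reflection in the hyperplane `⟨ξ, x⟩ = 1` (index `none`). -/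
def simpleReflection (b : P.Base) (ξ : ι) : Option b.support → affineWeylGroup P
  | some i => ⟨affineReflection P i 0, affineReflection_mem P i 0⟩
  | none => ⟨affineReflection P ξ 1, affineReflection_mem P ξ 1⟩

end AffineWeyl

end LimitWeak

/-! The criterion `infinitePowerIsFullyCommutative_translation_iff` replaces full commutativity of
$[t_\lambda^\infty]$ by a condition that is visibly invariant under conjugation: $t_\lambda\ne1$,
and no conjugate $gDg^{-1}$ of a finite dihedral parabolic subgroup $D$ with at least three
reflections has all its reflections failing to commute with $t_\lambda$ (`HasTransverseDihedral`).
Since $t_{w\lambda}=wt_\lambda w^{-1}$ inside the affine Weyl group (`translation_weylAct`), the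
theorem follows.

Inversions are treated geometrically: for $x$ in the fundamental alcove, the inversions of a reduced
word for $g$ are the reflections in the hyperplanes separating $x$ from $gx$ (`affineCocycle`). A
reflection commutes with $t_\lambda$ exactly when its root vanishes on $\lambda$, that is, when its
hyperplane is parallel to $\lambda$.

If $[t_\lambda^\infty]$ is not fully commutative, a braid factor in a reduced word of some prefix
puts a whole set of reflections of some $gDg^{-1}$ into the inversion set. That set is the union of
the inversion sets of the powers $t_\lambda^n$, and no hyperplane separating $x$ from $x+n\lambda$
is parallel to $\lambda$; so $gDg^{-1}$ is transverse.

Conversely, given a transverse $gDg^{-1}$, change $g$ so that $gx$ has all hyperplanes of $gDg^{-1}$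
ahead of it in the direction $\lambda$, and no hyperplane parallel to $\lambda$ separates $x$ from
$gx$ (`exists_isBehind_dihedral_and_notMem`). With $v$ the longest element of $D$ and $n$ large, the
path $x\to t_\lambda^n gx\to t_\lambda^n gvx\to t_\lambda^{2n}x$ crosses no hyperplane twice, so
$t_\lambda^{2n}$ has a reduced word containing a braid factor
(`HasTransverseDihedral.exists_not_isFullyCommutativeElt`). -/

namespace LimitWeak

/-! ### Inversion lists and reduced words -/

section Words

variable {B G : Type*} [Group G] (s : B → G)

@[simp] theorem wordProd_nil : wordProd s [] = 1 := rfl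

@[simp] theorem wordProd_cons (i : B) (L : List B) : wordProd s (i :: L) = s i * wordProd s L := by
  simp [wordProd]

@[simp] theorem wordProd_append (L L' : List B) :
    wordProd s (L ++ L') = wordProd s L * wordProd s L' := by
  simp [wordProd]

/-- The inversions of a word, listed in the order of its letters. -/
def inversionList : List B → List G
  | [] => []
  | i :: L => s i :: (inversionList L).map (MulAut.conj (s i))

theorem length_inversionList (L : List B) : (inversionList s L).length = L.length := by
  induction L with
  | nil => rfl
  | cons i L ih => simp [inversionList, ih]

theorem inversionList_append (L L' : List B) :
    inversionList s (L ++ L') =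
      inversionList s L ++ (inversionList s L').map (MulAut.conj (wordProd s L)) := by
  induction L with
  | nil => simp [inversionList]
  | cons i L ih => simp [inversionList, ih, Function.comp_def, mul_assoc]

theorem mem_inversions_iff (L : List B) (t : G) : t ∈ inversions s L ↔ t ∈ inversionList s L := by
  induction L generalizing t with
  | nil => simp [inversions, inversionList]
  | cons i L ih =>
    simp only [inversionList, List.mem_cons, List.mem_map, ← ih]
    constructor
    · rintro ⟨a, h, rfl⟩
      rcases a with _ | a
      · left; simp
      · right
        exact ⟨_, ⟨a, by simpa using h, rfl⟩, by simp [mul_assoc]⟩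
    · rintro (rfl | ⟨_, ⟨a, h, rfl⟩, rfl⟩)
      · exact ⟨0, by simp, by simp⟩
      · exact ⟨a + 1, by simpa using h, by simp [mul_assoc]⟩

theorem exists_isReducedWord (hsq : ∀ i, s i * s i = 1)
    (hgen : Subgroup.closure (Set.range s) = ⊤) (g : G) :
    ∃ L, IsReducedWord s L ∧ wordProd s L = g := by
  have hex : ∃ L, wordProd s L = g := by
    have hg : g ∈ Subgroup.closure (Set.range s) := hgen ▸ Subgroup.mem_top g
    induction hg using Subgroup.closure_induction with
    | mem g hg => obtain ⟨i, rfl⟩ := hg; exact ⟨[i], by simp⟩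
    | one => exact ⟨[], rfl⟩
    | mul g h _ _ hg hh =>
      obtain ⟨L, rfl⟩ := hg
      obtain ⟨L', rfl⟩ := hh
      exact ⟨L ++ L', by simp⟩
    | inv g _ hg =>
      obtain ⟨L, rfl⟩ := hg
      refine ⟨L.reverse, ?_⟩
      clear * - hsq
      induction L with
      | nil => simp
      | cons i L ih => simp [ih, inv_eq_of_mul_eq_one_left (hsq i)]
  obtain ⟨n, ⟨L, hL, rfl⟩, hmin⟩ : ∃ n, (∃ L : List B, wordProd s L = g ∧ L.length = n) ∧
      ∀ m, (∃ L : List B, wordProd s L = g ∧ L.length = m) → n ≤ m := by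
    classical
    have : ∃ n, ∃ L : List B, wordProd s L = g ∧ L.length = n := by
      obtain ⟨L, hL⟩ := hex; exact ⟨_, L, hL, rfl⟩
    exact ⟨Nat.find this, Nat.find_spec this, fun m hm => Nat.find_min' this hm⟩
  exact ⟨L, fun L' h' => hmin _ ⟨L', h'.trans hL, rfl⟩, hL⟩

/-- The exchange property for an inversion of a word. -/
theorem exists_wordProd_eq_mul (hsq : ∀ i, s i * s i = 1) {L : List B} {t : G}
    (ht : t ∈ inversionList s L) :
    ∃ L' : List B, wordProd s L' = t * wordProd s L ∧ L'.length + 1 = L.length := by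
  induction L generalizing t with
  | nil => simp [inversionList] at ht
  | cons i L ih =>
    simp only [inversionList, List.mem_cons, List.mem_map] at ht
    rcases ht with rfl | ⟨t, ht, rfl⟩
    · exact ⟨L, by simp [← mul_assoc, hsq], by simp⟩
    · obtain ⟨L', h1, h2⟩ := ih ht
      exact ⟨i :: L', by simp [h1, mul_assoc], by simp [h2]⟩

theorem IsReducedWord.of_cons {i : B} {L : List B} (h : IsReducedWord s (i :: L)) :
    IsReducedWord s L := by
  intro L' hL'
  simpa using h (i :: L') (by simp [hL'])

theorem IsReducedWord.nodup (hsq : ∀ i, s i * s i = 1) {L : List B} (h : IsReducedWord s L) :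
    (inversionList s L).Nodup := by
  induction L with
  | nil => simp [inversionList]
  | cons i L ih =>
    simp only [inversionList, List.nodup_cons]
    refine ⟨fun hmem => ?_, (ih h.of_cons).map (MulEquiv.injective _)⟩
    obtain ⟨t, ht, hti⟩ := List.mem_map.1 hmem
    have : t = s i := by
      have := congrArg (fun x => (s i)⁻¹ * x * s i) hti
      simpa [mul_assoc] using this
    subst this
    obtain ⟨L', h1, h2⟩ := exists_wordProd_eq_mul s hsq ht
    have := h L' (by simp [h1])
    simp only [List.length_cons] at this
    omega

/-! ### Reduced words through a reflection cocycle -/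

/-- A set-valued cocycle that sends each generator to its singleton. For a group generated by
reflections it sends an element to the hyperplanes that separate the base chamber from its image. -/
structure ReflectionCocycle where
  sep : G → Set G
  gen_mul_self : ∀ i, s i * s i = 1
  mem_mul_iff : ∀ g h t, t ∈ sep (g * h) ↔ Xor (t ∈ sep g) (g⁻¹ * t * g ∈ sep h)
  sep_gen : ∀ i, sep (s i) = {s i}

namespace ReflectionCocycle

variable {s} (N : ReflectionCocycle s)

include N

theorem sep_one : N.sep 1 = ∅ := by
  ext t
  have := N.mem_mul_iff 1 1 t
  simp only [mul_one, inv_one, one_mul] at this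
  unfold Xor at this
  simp only [Set.mem_empty_iff_false, iff_false]
  tauto

theorem mem_cons_iff (i : B) (g t : G) :
    t ∈ N.sep (s i * g) ↔ Xor (t = s i) ((s i)⁻¹ * t * s i ∈ N.sep g) := by
  rw [N.mem_mul_iff, N.sep_gen]; rfl

theorem mem_inversionList {L : List B} {t : G} (ht : t ∈ N.sep (wordProd s L)) :
    t ∈ inversionList s L := by
  induction L generalizing t with
  | nil => simp [sep_one] at ht
  | cons i L ih =>
    rw [wordProd_cons, mem_cons_iff] at ht
    simp only [inversionList, List.mem_cons, List.mem_map]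
    rcases ht with ⟨h, -⟩ | ⟨h, -⟩
    · exact Or.inl h
    · exact Or.inr ⟨_, ih h, by simp [mul_assoc]⟩

/-- Each letter toggles one reflection, so `sep` keeps the reflections of odd multiplicity in the
inversion list; without repetitions these are all of them. -/
theorem mem_sep_iff_of_nodup {L : List B} (hL : (inversionList s L).Nodup) (t : G) :
    t ∈ N.sep (wordProd s L) ↔ t ∈ inversionList s L := by
  refine ⟨N.mem_inversionList, ?_⟩
  induction L generalizing t with
  | nil => simp [inversionList]
  | cons i L ih =>
    simp only [inversionList, List.nodup_cons, List.mem_map, List.mem_cons] at hL ⊢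
    replace ih := ih (List.Nodup.of_map _ hL.2)
    rw [wordProd_cons, mem_cons_iff]
    rintro (rfl | ⟨t, ht, rfl⟩)
    · exact Or.inl ⟨rfl, fun h => hL.1 ⟨_, N.mem_inversionList h, by simp [mul_assoc]⟩⟩
    · refine Or.inr ⟨by simpa [mul_assoc] using ih _ ht, fun h => hL.1 ⟨t, ht, h⟩⟩

/-- For a list without repetitions, `sep` has as many elements as the word has letters. As `sep`
depends only on the product and is contained in the inversion list of every word for it, no such
word is shorter. -/
theorem isReducedWord_iff {L : List B} : IsReducedWord s L ↔ (inversionList s L).Nodup := by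
  classical
  refine ⟨fun h => h.nodup s N.gen_mul_self, fun h L' hL' => ?_⟩
  rw [← length_inversionList s L, ← length_inversionList s L', ← List.toFinset_card_of_nodup h]
  refine (Finset.card_le_card ?_).trans (List.toFinset_card_le _)
  intro t ht
  rw [List.mem_toFinset] at ht ⊢
  rw [← N.mem_sep_iff_of_nodup h, ← hL'] at ht
  exact N.mem_inversionList ht

theorem mem_sep_iff {L : List B} (hL : IsReducedWord s L) (t : G) :
    t ∈ N.sep (wordProd s L) ↔ t ∈ inversionList s L :=
  N.mem_sep_iff_of_nodup (N.isReducedWord_iff.1 hL) t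

theorem inversions_eq {L : List B} (hL : IsReducedWord s L) :
    inversions s L = N.sep (wordProd s L) := by
  ext t
  rw [mem_inversions_iff, N.mem_sep_iff hL]

theorem ncard_sep {L : List B} (hL : IsReducedWord s L) :
    (N.sep (wordProd s L)).ncard = L.length := by
  classical
  have : N.sep (wordProd s L) = ((inversionList s L).toFinset : Set G) := by
    ext t; simp [N.mem_sep_iff hL]
  rw [this, Set.ncard_coe_finset, List.toFinset_card_of_nodup (N.isReducedWord_iff.1 hL),
    length_inversionList]

/-- The strong exchange property. -/
theorem ncard_sep_mul_lt (hgen : Subgroup.closure (Set.range s) = ⊤) {g t : G}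
    (ht : t ∈ N.sep g) : (N.sep (t * g)).ncard < (N.sep g).ncard := by
  obtain ⟨L, hL, rfl⟩ := exists_isReducedWord s N.gen_mul_self hgen g
  obtain ⟨L', h1, h2⟩ := exists_wordProd_eq_mul s N.gen_mul_self (N.mem_inversionList ht)
  obtain ⟨M, hM, hMg⟩ := exists_isReducedWord s N.gen_mul_self hgen (t * wordProd s L)
  have := hM L' (h1.trans hMg.symm)
  rw [N.ncard_sep hL, ← hMg, N.ncard_sep hM]
  omega

/-- The inversion list of a concatenation is that of the left factor followed by a conjugate of that
of the right factor, so what remains is disjointness: no hyperplane is crossed in both halves. -/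
theorem isReducedWord_append {L L' : List B} :
    IsReducedWord s (L ++ L') ↔ IsReducedWord s L ∧ IsReducedWord s L' ∧
      ∀ t ∈ N.sep (wordProd s L), (wordProd s L)⁻¹ * t * wordProd s L ∉ N.sep (wordProd s L') := by
  simp only [N.isReducedWord_iff, inversionList_append, List.nodup_append']
  refine and_congr_right fun h => ?_
  rw [List.nodup_map_iff (MulEquiv.injective _)]
  refine and_congr_right fun h' => ?_
  rw [List.disjoint_left]
  simp only [N.mem_sep_iff_of_nodup h, N.mem_sep_iff_of_nodup h']
  refine forall₂_congr fun t _ => not_congr ?_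
  rw [List.mem_map]
  constructor
  · rintro ⟨a, ha, rfl⟩; simpa [mul_assoc] using ha
  · exact fun h => ⟨_, h, by simp [mul_assoc]⟩

end ReflectionCocycle

/-! ### Alternating words and dihedral reflections -/

/-- The word `p q p q ⋯` of length `n`. -/
def zigzag (p q : B) : ℕ → List B
  | 0 => []
  | n + 1 => p :: zigzag q p n

/-- `alternatingWord` is pinned at its last letter and `zigzag` at its first, hence the dependence
on parity. -/
theorem alternatingWord_eq_zigzag (i j : B) (m : ℕ) :
    CoxeterSystem.alternatingWord i j m = if Even m then zigzag i j m else zigzag j i m := by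
  induction m with
  | zero => simp [zigzag, CoxeterSystem.alternatingWord]
  | succ m ih =>
    rw [CoxeterSystem.alternatingWord_succ', ih]
    by_cases h : Even m <;> simp [h, Nat.even_add_one, zigzag]

theorem inversionList_zigzag (hsq : ∀ i, s i * s i = 1) (p q : B) (n : ℕ) :
    inversionList s (zigzag p q n) = (List.range n).map fun k => (s p * s q) ^ k * s p := by
  induction n generalizing p q with
  | zero => rfl
  | succ n ih =>
    have hinv (i : B) : (s i)⁻¹ = s i := inv_eq_of_mul_eq_one_left (hsq i)
    have hshift (k : ℕ) : s p * (s q * s p) ^ k = (s p * s q) ^ k * s p := by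
      induction k with
      | zero => simp
      | succ k ih => rw [pow_succ, ← mul_assoc, ih, pow_succ]; simp [mul_assoc]
    rw [zigzag, inversionList, ih, List.range_succ_eq_map]
    simp only [List.map_map, List.map_cons, pow_zero, one_mul, List.cons.injEq, true_and]
    refine List.map_congr_left fun k _ => ?_
    simp only [Function.comp_apply, MulAut.conj_apply, hinv]
    rw [pow_succ, ← mul_assoc, hshift]
    simp [mul_assoc]

/-- The reflections in the dihedral group generated by `s i` and `s j`. -/
def dihedralReflections (i j : B) : Set G := {t | ∃ k : ℤ, t = (s i * s j) ^ k * s i}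

theorem dihedralReflections_comm (hsq : ∀ i, s i * s i = 1) (i j : B) :
    dihedralReflections s i j = dihedralReflections s j i := by
  have key (i j : B) : dihedralReflections s i j ⊆ dihedralReflections s j i := by
    rintro _ ⟨k, rfl⟩
    have h : s i * s j = (s j * s i)⁻¹ := by
      rw [eq_inv_iff_mul_eq_one]; simp [mul_assoc, ← mul_assoc (s j), hsq]
    refine ⟨-k - 1, ?_⟩
    rw [h, inv_zpow', zpow_sub_one, mul_inv_rev, mul_assoc, mul_assoc,
      inv_eq_of_mul_eq_one_left (hsq j), hsq, mul_one, inv_eq_of_mul_eq_one_left (hsq i)]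
  exact (key i j).antisymm (key j i)

theorem conj_gen_mem_dihedralReflections (hsq : ∀ i, s i * s i = 1) {i j : B} {t : G}
    (ht : t ∈ dihedralReflections s i j) : s i * t * (s i)⁻¹ ∈ dihedralReflections s i j := by
  obtain ⟨k, rfl⟩ := ht
  refine ⟨-k, ?_⟩
  have h : s i * (s i * s j) * (s i)⁻¹ = (s i * s j)⁻¹ := by
    rw [eq_inv_iff_mul_eq_one, inv_eq_of_mul_eq_one_left (hsq i)]
    simp [mul_assoc, ← mul_assoc (s i) (s i), hsq]
  rw [zpow_neg, ← inv_zpow, ← h, conj_zpow]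
  simp [mul_assoc]

theorem conj_mem_dihedralReflections (hsq : ∀ i, s i * s i = 1) {i j : B} {t u : G}
    (hu : u ∈ Subgroup.closure {s i, s j}) (ht : t ∈ dihedralReflections s i j) :
    u * t * u⁻¹ ∈ dihedralReflections s i j := by
  have hinv (i : B) : (s i)⁻¹ = s i := inv_eq_of_mul_eq_one_left (hsq i)
  have hgen : ∀ x ∈ ({s i, s j} : Set G), ∀ t ∈ dihedralReflections s i j,
      x * t * x⁻¹ ∈ dihedralReflections s i j := by
    rintro x (rfl | rfl) t ht
    · exact conj_gen_mem_dihedralReflections s hsq ht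
    · rw [dihedralReflections_comm s hsq] at ht ⊢
      exact conj_gen_mem_dihedralReflections s hsq ht
  induction hu using Subgroup.closure_induction'' generalizing t with
  | mem x hx => exact hgen x hx t ht
  | inv_mem x hx =>
    have : x⁻¹ = x := by rcases hx with rfl | rfl <;> exact hinv _
    rw [this]
    exact hgen x hx t ht
  | one => simpa using ht
  | mul x y _ _ hx hy => simpa [mul_assoc] using hx (hy ht)

theorem mem_closure_of_mem_dihedralReflections {i j : B} {t : G}
    (ht : t ∈ dihedralReflections s i j) : t ∈ Subgroup.closure {s i, s j} := by
  obtain ⟨k, rfl⟩ := ht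
  have hi : s i ∈ Subgroup.closure {s i, s j} := Subgroup.subset_closure (by simp)
  have hj : s j ∈ Subgroup.closure {s i, s j} := Subgroup.subset_closure (by simp)
  exact mul_mem (zpow_mem (mul_mem hi hj) k) hi

theorem mem_inversionList_zigzag_orderOf (hsq : ∀ i, s i * s i = 1) {i j : B}
    (h : 0 < orderOf (s i * s j)) (t : G) :
    t ∈ inversionList s (zigzag i j (orderOf (s i * s j))) ↔ t ∈ dihedralReflections s i j := by
  simp only [inversionList_zigzag s hsq, List.mem_map, List.mem_range]
  constructor
  · rintro ⟨k, -, rfl⟩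
    exact ⟨k, by simp⟩
  · rintro ⟨k, rfl⟩
    have hpos : (0 : ℤ) < orderOf (s i * s j) := by exact_mod_cast h
    -- Exponents matter only modulo the order, so every dihedral reflection occurs among the first
    -- `orderOf` powers.
    refine ⟨(k % orderOf (s i * s j)).toNat, ?_, ?_⟩
    · have := Int.emod_lt_of_pos k hpos
      omega
    · rw [← zpow_natCast, Int.toNat_of_nonneg (Int.emod_nonneg k hpos.ne'), zpow_mod_orderOf]

theorem orderOf_gen_mul_comm (hsq : ∀ i, s i * s i = 1) (i j : B) :
    orderOf (s j * s i) = orderOf (s i * s j) := by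
  have h : s j * s i = (s i * s j)⁻¹ := by
    rw [mul_inv_rev, inv_eq_of_mul_eq_one_left (hsq i), inv_eq_of_mul_eq_one_left (hsq j)]
  rw [h, orderOf_inv]

theorem mem_inversionList_alternatingWord (hsq : ∀ i, s i * s i = 1) {i j : B}
    (h : 0 < orderOf (s i * s j)) (t : G) :
    t ∈ inversionList s (CoxeterSystem.alternatingWord i j (orderOf (s i * s j))) ↔
      t ∈ dihedralReflections s i j := by
  rw [alternatingWord_eq_zigzag]
  split
  · exact mem_inversionList_zigzag_orderOf s hsq h t
  · rw [dihedralReflections_comm s hsq, ← orderOf_gen_mul_comm s hsq]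
    exact mem_inversionList_zigzag_orderOf s hsq (by rwa [orderOf_gen_mul_comm s hsq]) t

theorem nodup_inversionList_alternatingWord (hsq : ∀ i, s i * s i = 1) (i j : B) :
    (inversionList s (CoxeterSystem.alternatingWord i j (orderOf (s i * s j)))).Nodup := by
  have key (p q : B) : (inversionList s (zigzag p q (orderOf (s p * s q)))).Nodup := by
    rw [inversionList_zigzag s hsq]
    refine List.Nodup.map_on ?_ List.nodup_range
    intro a ha b hb hab
    rw [List.mem_range] at ha hb
    exact pow_injOn_Iio_orderOf ha hb (mul_right_cancel hab)
  rw [alternatingWord_eq_zigzag]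
  split
  · exact key i j
  · rw [← orderOf_gen_mul_comm s hsq]
    exact key j i

/-- Some conjugate of a finite dihedral parabolic subgroup with at least three reflections has no
reflection that commutes with `T`. -/
def HasTransverseDihedral (T : G) : Prop :=
  ∃ (g : G) (i j : B), 3 ≤ orderOf (s i * s j) ∧
    ∀ t ∈ dihedralReflections s i j, ¬ Commute (g * t * g⁻¹) T

theorem HasTransverseDihedral.conj {T : G} (h : HasTransverseDihedral s T) (w : G) :
    HasTransverseDihedral s (w * T * w⁻¹) := by
  obtain ⟨g, i, j, hm, ht⟩ := h
  refine ⟨w * g, i, j, hm, fun t htm hc => ht t htm ?_⟩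
  have : w * g * t * (w * g)⁻¹ = w * (g * t * g⁻¹) * w⁻¹ := by simp [mul_assoc]
  rwa [this, Commute.conj_iff] at hc

end Words

/-! ### Affine reflections and separating hyperplanes -/

section AffineWeyl

variable {ι M N : Type*} [AddCommGroup M] [Module ℝ M] [AddCommGroup N] [Module ℝ N]
  (P : RootPairing ι ℝ M N)

theorem affineEquiv_mul_apply (g h : N ≃ᵃ[ℝ] N) (x : N) : (g * h) x = g (h x) := rfl

theorem affineEquiv_inv_apply_self (g : N ≃ᵃ[ℝ] N) (x : N) : g⁻¹ (g x) = x := g.symm_apply_apply x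

theorem root'_reflectionPerm_apply (i j : ι) (x : N) :
    P.root' (P.reflectionPerm i j) x = P.root' j x - P.pairing j i * P.root' i x := by
  have := congrArg (fun m => P.toLinearMap m x) (P.reflectionPerm_root i j)
  simp only [map_sub, map_smul, LinearMap.sub_apply, LinearMap.smul_apply, smul_eq_mul] at this
  exact this.symm

theorem root'_affineReflection (i j : ι) (k : ℤ) (x : N) :
    P.root' j (affineReflection P i k x) =
      P.root' (P.reflectionPerm i j) x + k * P.pairing j i := by
  rw [affineReflection_apply, root'_reflectionPerm_apply, map_sub, map_smul,
    RootPairing.root'_coroot_eq_pairing, smul_eq_mul]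
  ring

theorem affineReflection_mul_self (i : ι) (k : ℤ) :
    affineReflection P i k * affineReflection P i k = 1 := by
  ext x
  have h := root'_affineReflection P i i k x
  rw [root'_reflectionPerm_apply, RootPairing.pairing_same] at h
  rw [affineEquiv_mul_apply, affineReflection_apply P i k (affineReflection P i k x), h,
    affineReflection_apply]
  change _ = x
  module

theorem affineReflection_inv (i : ι) (k : ℤ) :
    (affineReflection P i k)⁻¹ = affineReflection P i k :=
  inv_eq_of_mul_eq_one_left (affineReflection_mul_self P i k)

theorem affineReflection_of_root_eq_neg [P.IsRootSystem] {i j : ι} (h : P.root j = -P.root i)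
    (k : ℤ) : affineReflection P j (-k) = affineReflection P i k := by
  have hj : j = P.reflectionPerm i i := P.root.injective (by rw [h]; simp)
  have hc : P.coroot j = -P.coroot i := by rw [hj]; simp
  ext x
  have hr : P.root' j x = -P.root' i x := by
    change P.toLinearMap (P.root j) x = _
    rw [h]; simp
  rw [affineReflection_apply, affineReflection_apply, hc, hr]
  push_cast
  module

/-- Applying the root `i` to both reflections gives the proportionality, with factor half of
`P.pairing i j`. Were the pairing zero, the affine form of `i` would vanish at both `0` and
`P.coroot i`, where its values differ by 2. This makes the later sign conditions independent of the
pair that represents a reflection. -/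
theorem affineReflection_eq_iff_exists {i j : ι} {k l : ℤ}
    (h : affineReflection P i k = affineReflection P j l) :
    ∃ c : ℝ, c ≠ 0 ∧ ∀ x, P.root' i x - k = c * (P.root' j x - l) := by
  have key (x : N) : 2 * (P.root' i x - k) = P.pairing i j * (P.root' j x - l) := by
    have hx := congrArg (P.root' i) (DFunLike.congr_fun h x)
    simp only [affineReflection_apply, map_sub, map_smul, RootPairing.root'_coroot_eq_pairing,
      smul_eq_mul, RootPairing.pairing_same] at hx
    linarith
  refine ⟨P.pairing i j / 2, ?_, fun x => by linarith [key x]⟩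
  intro h0
  have h0 : P.pairing i j = 0 := by linarith
  have h1 := key (P.coroot i)
  have h2 := key 0
  simp only [h0, zero_mul, map_zero, RootPairing.root'_coroot_eq_pairing,
    RootPairing.pairing_same] at h1 h2
  linarith

theorem affineReflection_mul_comm [P.IsCrystallographic] (i j : ι) (k l : ℤ) :
    affineReflection P j l * affineReflection P i k =
      affineReflection P i k *
        affineReflection P (P.reflectionPerm i j) (l - k * P.pairingIn ℤ j i) := by
  have hp : ((P.pairingIn ℤ j i : ℤ) : ℝ) = P.pairing j i := by
    simpa using P.algebraMap_pairingIn ℤ j i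
  ext x
  rw [affineEquiv_mul_apply, affineEquiv_mul_apply, affineReflection_apply P j,
    root'_affineReflection, affineReflection_apply P i k,
    affineReflection_apply P i k, affineReflection_apply P (P.reflectionPerm i j),
    RootPairing.coroot_reflectionPerm, RootPairing.coreflection_apply_coroot]
  simp only [map_sub, map_smul, RootPairing.root'_coroot_eq_pairing,
      smul_eq_mul, RootPairing.pairing_same, Int.cast_sub, Int.cast_mul, hp]
  module

/-- One pair `(j', l')` must serve both for the conjugated reflection and for the pulled-back affine
form, so that signs can be transported along `g`. -/
theorem exists_affineReflection_conj [P.IsCrystallographic] {g : N ≃ᵃ[ℝ] N}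
    (hg : g ∈ affineWeylGroup P) (j : ι) (l : ℤ) :
    ∃ (j' : ι) (l' : ℤ), (∀ x, P.root' j (g x) - l = P.root' j' x - l') ∧
      g⁻¹ * affineReflection P j l * g = affineReflection P j' l' := by
  have hgen (i : ι) (k : ℤ) (j : ι) (l : ℤ) :
      ∃ (j' : ι) (l' : ℤ), (∀ x, P.root' j (affineReflection P i k x) - l = P.root' j' x - l') ∧
      (affineReflection P i k)⁻¹ * affineReflection P j l * affineReflection P i k =
        affineReflection P j' l' := by
    have hp : ((P.pairingIn ℤ j i : ℤ) : ℝ) = P.pairing j i := by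
      simpa using P.algebraMap_pairingIn ℤ j i
    refine ⟨P.reflectionPerm i j, l - k * P.pairingIn ℤ j i, fun x => ?_, ?_⟩
    · rw [root'_affineReflection, Int.cast_sub, Int.cast_mul, hp]
      ring
    · rw [mul_assoc, inv_mul_eq_iff_eq_mul, affineReflection_mul_comm]
  unfold affineWeylGroup at hg
  induction hg using Subgroup.closure_induction'' generalizing j l with
  | mem g hg => obtain ⟨i, k, rfl⟩ := hg; exact hgen i k j l
  | inv_mem g hg =>
    obtain ⟨i, k, rfl⟩ := hg
    rw [affineReflection_inv]
    simpa only [affineReflection_inv] using hgen i k j l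
  | one => exact ⟨j, l, fun x => rfl, by simp⟩
  | mul g h _ _ hg hh =>
    obtain ⟨j', l', h1, h2⟩ := hg j l
    obtain ⟨j'', l'', h3, h4⟩ := hh j' l'
    refine ⟨j'', l'', fun x => ?_, ?_⟩
    · rw [affineEquiv_mul_apply, h1, h3]
    · rw [← h4, ← h2]; simp [mul_assoc]

/-- The reflections in the hyperplanes that separate `x` and `y`. -/
def separators (x y : N) : Set (affineWeylGroup P) :=
  {t | ∃ (i : ι) (k : ℤ), (t : N ≃ᵃ[ℝ] N) = affineReflection P i k ∧
    (P.root' i x - k) * (P.root' i y - k) < 0}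

theorem mem_separators_iff {t : affineWeylGroup P} {i : ι} {k : ℤ}
    (ht : (t : N ≃ᵃ[ℝ] N) = affineReflection P i k) (x y : N) :
    t ∈ separators P x y ↔ (P.root' i x - k) * (P.root' i y - k) < 0 := by
  refine ⟨?_, fun h => ⟨i, k, ht, h⟩⟩
  rintro ⟨j, l, htj, h⟩
  obtain ⟨c, hc, hcx⟩ := affineReflection_eq_iff_exists P (ht.symm.trans htj)
  rw [hcx, hcx]
  nlinarith [mul_pos_of_neg_of_neg h (neg_neg_of_pos (sq_pos_of_ne_zero hc))]

theorem conj_mem_separators [P.IsCrystallographic] {t : affineWeylGroup P} {x y : N}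
    (g : affineWeylGroup P)
    (h : t ∈ separators P x y) :
    g * t * g⁻¹ ∈ separators P ((g : N ≃ᵃ[ℝ] N) x) ((g : N ≃ᵃ[ℝ] N) y) := by
  obtain ⟨i, k, ht, h⟩ := h
  obtain ⟨j, l, h1, h2⟩ := exists_affineReflection_conj P (g⁻¹).2 i k
  refine ⟨j, l, by simpa [ht] using h2, ?_⟩
  rw [← h1, ← h1]
  simpa [affineEquiv_inv_apply_self] using h

theorem conj_mem_separators_iff [P.IsCrystallographic] {t : affineWeylGroup P} {x y : N}
    (g : affineWeylGroup P) :
    g * t * g⁻¹ ∈ separators P ((g : N ≃ᵃ[ℝ] N) x) ((g : N ≃ᵃ[ℝ] N) y) ↔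
      t ∈ separators P x y := by
  refine ⟨fun h => ?_, conj_mem_separators P g⟩
  have := conj_mem_separators P g⁻¹ h
  simpa [mul_assoc, affineEquiv_inv_apply_self] using this

/-- A point that lies on none of the hyperplanes `⟨α, x⟩ = k`. -/
def IsRegularPoint (x : N) : Prop := ∀ (i : ι) (k : ℤ), P.root' i x - k ≠ 0

theorem IsRegularPoint.apply [P.IsCrystallographic] {x : N} (hx : IsRegularPoint P x)
    (g : affineWeylGroup P) :
    IsRegularPoint P ((g : N ≃ᵃ[ℝ] N) x) := by
  intro i k
  obtain ⟨j, l, h1, -⟩ := exists_affineReflection_conj P g.2 i k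
  rw [h1]
  exact hx j l

theorem mem_separators_trans_iff {x y z : N} (hx : IsRegularPoint P x)
    (hy : IsRegularPoint P y) (hz : IsRegularPoint P z) (t : affineWeylGroup P) :
    t ∈ separators P x z ↔ Xor (t ∈ separators P x y) (t ∈ separators P y z) := by
  by_cases h : ∃ (i : ι) (k : ℤ), (t : N ≃ᵃ[ℝ] N) = affineReflection P i k
  · obtain ⟨i, k, ht⟩ := h
    simp only [mem_separators_iff P ht, mul_neg_iff, Xor]
    have h1 := hx i k
    have h2 := hy i k
    have h3 := hz i k
    rcases lt_or_gt_of_ne h1 with h1 | h1 <;> rcases lt_or_gt_of_ne h2 with h2 | h2 <;>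
      rcases lt_or_gt_of_ne h3 with h3 | h3 <;> simp [h1, h2, h3, h1.not_gt, h2.not_gt, h3.not_gt]
  · have hn (x y : N) : t ∉ separators P x y := fun ⟨i, k, ht, _⟩ => h ⟨i, k, ht⟩
    simp [hn, Xor]

variable {P}

theorem translation_pow_apply (l : P.corootSpan ℤ) (n : ℕ) (x : N) :
    ((translation P l ^ n : affineWeylGroup P) : N ≃ᵃ[ℝ] N) x = (n : ℝ) • (l : N) + x := by
  induction n generalizing x with
  | zero => simp
  | succ n ih =>
    rw [pow_succ, Subgroup.coe_mul, affineEquiv_mul_apply, ih, translation_apply]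
    push_cast
    module

theorem commute_translation_iff {t : affineWeylGroup P} {i : ι} {k : ℤ}
    (ht : (t : N ≃ᵃ[ℝ] N) = affineReflection P i k) (l : P.corootSpan ℤ) :
    Commute t (translation P l) ↔ P.root' i (l : N) = 0 := by
  have hcomm : Commute t (translation P l) ↔
      ∀ x, affineReflection P i k (l + x) = l + affineReflection P i k x := by
    rw [commute_iff_eq, Subtype.ext_iff, AffineEquiv.ext_iff]
    refine forall_congr' fun x => ?_
    rw [Subgroup.coe_mul, Subgroup.coe_mul, affineEquiv_mul_apply, affineEquiv_mul_apply,
      translation_apply, translation_apply, ht]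
  rw [hcomm]
  have key (x : N) : affineReflection P i k (l + x) =
      l + affineReflection P i k x - P.root' i (l : N) • P.coroot i := by
    rw [affineReflection_apply, affineReflection_apply, map_add]
    module
  simp only [key, sub_eq_self, smul_eq_zero, P.ne_zero' i, or_false, forall_const]

theorem translation_weylAct (w : weylGroup P) (l : P.corootSpan ℤ) :
    ∃ g : affineWeylGroup P, translation P (weylAct P w l) = g * translation P l * g⁻¹ := by
  obtain ⟨w, hw⟩ := w
  have hmem : w.toAffineEquiv ∈ affineWeylGroup P := by
    have hle : weylGroup P ≤ (affineWeylGroup P).comap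
        ({ toFun := LinearEquiv.toAffineEquiv, map_one' := rfl, map_mul' := fun _ _ => rfl } :
          (N ≃ₗ[ℝ] N) →* (N ≃ᵃ[ℝ] N)) := by
      rw [weylGroup, Subgroup.closure_le]
      rintro _ ⟨i, rfl⟩
      have : (P.coreflection i).toAffineEquiv = affineReflection P i 0 := by
        ext x; simp [affineReflection, AffineEquiv.mul_def]
      change (P.coreflection i).toAffineEquiv ∈ affineWeylGroup P
      rw [this]
      exact affineReflection_mem P i 0
    exact hle hw
  refine ⟨⟨_, hmem⟩, ?_⟩
  rw [eq_mul_inv_iff_mul_eq]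
  ext x
  simp [translation_apply, weylAct]

end AffineWeyl

/-! ### The fundamental alcove and the crossing of its walls -/

section Alcove

variable {ι M N : Type*} [AddCommGroup M] [Module ℝ M] [AddCommGroup N] [Module ℝ N]
  {P : RootPairing ι ℝ M N}

/-- `x` lies in the open fundamental alcove. -/
structure IsAlcovePoint (b : P.Base) (ξ : ι) (x : N) : Prop where
  simple_pos : ∀ i ∈ b.support, 0 < P.root' i x
  highest_lt_one : P.root' ξ x < 1

/-- The height functional, equal to 1 on simple roots, is evaluation at a point because the pairing
is perfect; dividing that point by one more than the height of `ξ` brings it below the affine wall.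
-/
theorem exists_isAlcovePoint [P.IsRootSystem] (b : P.Base) {ξ : ι} (hξ : IsHighestRoot b ξ) :
    ∃ x, IsAlcovePoint b ξ x := by
  let φ : M →ₗ[ℝ] ℝ := b.toWeightBasis.constr ℝ fun _ => (1 : ℝ)
  have hφ (i : ι) (hi : i ∈ b.support) : φ (P.root i) = 1 := by
    have := b.toWeightBasis.constr_basis ℝ (fun _ => (1 : ℝ)) ⟨i, hi⟩
    rwa [RootPairing.Base.toWeightBasis_apply] at this
  have hnonneg (m : M) (hm : m ∈ AddSubmonoid.closure (P.root '' b.support)) : 0 ≤ φ m := by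
    induction hm using AddSubmonoid.closure_induction with
    | mem x hx => obtain ⟨i, hi, rfl⟩ := hx; rw [hφ i hi]; exact zero_le_one
    | zero => simp
    | add x y _ _ hx hy => rw [map_add]; positivity
  obtain ⟨y, hy⟩ := (LinearMap.IsPerfPair.bijective_right P.toLinearMap).surjective φ
  have hy (m : M) : P.toLinearMap m y = φ m := DFunLike.congr_fun hy m
  have hξ0 : 0 ≤ φ (P.root ξ) := by
    have h1 := hnonneg _ (hξ (P.reflectionPerm ξ ξ))
    simp only [RootPairing.root_reflectionPerm, RootPairing.reflection_apply_self,
      sub_neg_eq_add, map_add] at h1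
    linarith
  refine ⟨(φ (P.root ξ) + 1)⁻¹ • y, ⟨fun i hi => ?_, ?_⟩⟩
  · change 0 < P.toLinearMap (P.root i) _
    rw [map_smul, hy, hφ i hi, smul_eq_mul]
    positivity
  · change P.toLinearMap (P.root ξ) _ < 1
    rw [map_smul, hy, smul_eq_mul, inv_mul_lt_one₀ (by positivity)]
    linarith

namespace IsAlcovePoint

variable {b : P.Base} {ξ : ι} {x : N} (hx : IsAlcovePoint b ξ x)

include hx

theorem eq_zero_or_pos {m : M} (hm : m ∈ AddSubmonoid.closure (P.root '' b.support)) :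
    m = 0 ∨ 0 < P.toLinearMap m x := by
  induction hm using AddSubmonoid.closure_induction with
  | mem m hm => obtain ⟨i, hi, rfl⟩ := hm; exact Or.inr (hx.simple_pos i hi)
  | zero => exact Or.inl rfl
  | add m m' _ _ h h' =>
    rw [map_add, LinearMap.add_apply]
    rcases h with rfl | h <;> rcases h' with rfl | h'
    · simp
    · right; simpa using h'
    · right; simpa using h
    · right; positivity

theorem root'_ne_zero (i : ι) : P.root' i x ≠ 0 := by
  rcases b.root_mem_or_neg_mem i with h | h
  · exact ((hx.eq_zero_or_pos h).resolve_left (P.ne_zero i)).ne'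
  · have := (hx.eq_zero_or_pos h).resolve_left (neg_ne_zero.2 (P.ne_zero i))
    rw [map_neg, LinearMap.neg_apply, neg_pos] at this
    exact this.ne

theorem pos_of_isPos [Finite ι] [P.IsCrystallographic] {i : ι} (hi : b.IsPos i) : 0 < P.root' i x := by
  refine hi.induction_on_add (p := fun i => 0 < P.root' i x) hx.simple_pos ?_
  intro i j k hk hi hj
  have h1 := hx.simple_pos j hj
  change 0 < P.toLinearMap (P.root k) x
  rw [hk, map_add, LinearMap.add_apply]
  exact add_pos hi h1

theorem isPos_iff [Finite ι] [P.IsCrystallographic] [P.IsReduced] {i : ι} :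
    b.IsPos i ↔ 0 < P.root' i x := by
  refine ⟨hx.pos_of_isPos, fun h => ?_⟩
  by_contra hn
  let := P.indexNeg
  have := hx.pos_of_isPos ((RootPairing.Base.IsPos.neg_iff_not b i).2 hn)
  rw [RootPairing.indexNeg_neg, root'_reflectionPerm_apply, RootPairing.pairing_same] at this
  linarith

variable (hξ : IsHighestRoot b ξ)

include hξ

theorem eq_or_root'_lt (i : ι) : P.root i = P.root ξ ∨ P.root' i x < P.root' ξ x := by
  rcases hx.eq_zero_or_pos (hξ i) with h | h
  · exact Or.inl (sub_eq_zero.1 h).symm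
  · rw [map_sub, LinearMap.sub_apply, sub_pos] at h
    exact Or.inr h

theorem eq_neg_or_lt_root' (i : ι) : P.root i = -P.root ξ ∨ -P.root' ξ x < P.root' i x := by
  rcases hx.eq_or_root'_lt hξ (P.reflectionPerm i i) with h | h
  · left; rw [← h]; simp
  · right
    rw [root'_reflectionPerm_apply, RootPairing.pairing_same] at h
    linarith

theorem root'_le (i : ι) : P.root' i x ≤ P.root' ξ x := by
  rcases hx.eq_or_root'_lt hξ i with h | h
  · rw [P.root.injective h]
  · exact h.le

theorem neg_le_root' (i : ι) : -P.root' ξ x ≤ P.root' i x := by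
  rcases hx.eq_neg_or_lt_root' hξ i with h | h
  · change _ ≤ P.toLinearMap (P.root i) x
    rw [h]; simp [RootPairing.root']
  · exact h.le

theorem highest_pos : 0 < P.root' ξ x := by
  have h1 := hx.neg_le_root' hξ ξ
  have h2 := hx.root'_ne_zero ξ
  exact lt_of_le_of_ne (by linarith) h2.symm

theorem isRegularPoint : IsRegularPoint P x := by
  intro i k h
  have h1 := hx.root'_le hξ i
  have h2 := hx.neg_le_root' hξ i
  have h3 := hx.highest_lt_one
  have hk1 : (k : ℝ) < 1 := by linarith
  have hk2 : (-1 : ℝ) < k := by linarith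
  have hk : k = 0 := by
    have : k < 1 := by exact_mod_cast hk1
    have : -1 < k := by exact_mod_cast hk2
    omega
  subst hk
  exact hx.root'_ne_zero i (by simpa using h)

variable [P.IsCrystallographic]

/-- If $n=\langle\alpha,\xi^\vee\rangle\ge2$, then $\alpha-n\xi$ is at least $-\xi$ at $x$, so
$\alpha(x)\ge\xi(x)$, which forces $\alpha=\xi$; symmetrically for $n\le-2$. -/
theorem pairingIn_highest (i : ι) : P.pairingIn ℤ i ξ = -1 ∨ P.pairingIn ℤ i ξ = 0 ∨
    P.pairingIn ℤ i ξ = 1 ∨ P.root i = P.root ξ ∨ P.root i = -P.root ξ := by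
  have hp : ((P.pairingIn ℤ i ξ : ℤ) : ℝ) = P.pairing i ξ := by
    simpa using P.algebraMap_pairingIn ℤ i ξ
  have h1 := root'_reflectionPerm_apply P ξ i x
  have h2 := hx.neg_le_root' hξ (P.reflectionPerm ξ i)
  have h3 := hx.root'_le hξ (P.reflectionPerm ξ i)
  have h4 := hx.highest_pos hξ
  rw [← hp] at h1
  generalize P.pairingIn ℤ i ξ = n at h1
  by_cases h : -1 ≤ n ∧ n ≤ 1
  · omega
  · rcases lt_or_ge 1 n with hn | hn
    · have : (2 : ℝ) ≤ n := by exact_mod_cast hn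
      rcases hx.eq_or_root'_lt hξ i with h5 | h5
      · tauto
      · nlinarith
    · have : (n : ℝ) ≤ -2 := by
        have : n ≤ -2 := by omega
        exact_mod_cast this
      rcases hx.eq_neg_or_lt_root' hξ i with h5 | h5
      · tauto
      · nlinarith

/-- When the pairing with $\xi^\vee$ is $0$, the root takes the same value at both points. When it
is $1$ both values lie in $(0,1)$, and when it is $-1$ both lie in $(-1,0)$, leaving no integer
between them. Only $\pm\xi$ remain, and then $k=\pm1$. -/
theorem eq_of_separates_highest [P.IsRootSystem] {i : ι} {k : ℤ}
    (h : (P.root' i x - k) * (P.root' i (affineReflection P ξ 1 x) - k) < 0) :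
    affineReflection P i k = affineReflection P ξ 1 := by
  have hp : ((P.pairingIn ℤ i ξ : ℤ) : ℝ) = P.pairing i ξ := by
    simpa using P.algebraMap_pairingIn ℤ i ξ
  have h2 := hx.neg_le_root' hξ (P.reflectionPerm ξ i)
  have h3 := hx.root'_le hξ (P.reflectionPerm ξ i)
  have h4 := hx.highest_pos hξ
  have h5 := hx.highest_lt_one
  have h6 := hx.root'_ne_zero (P.reflectionPerm ξ i)
  have h7 := hx.root'_ne_zero i
  have h8 := hx.root'_le hξ i
  have h9 := hx.neg_le_root' hξ i
  rw [root'_affineReflection] at h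
  rw [root'_reflectionPerm_apply] at h h2 h3 h6
  rw [← hp] at h h2 h3 h6
  have hk : (k : ℝ) ≤ -1 ∨ (k : ℝ) = 0 ∨ 1 ≤ (k : ℝ) := by
    rcases (by omega : k ≤ -1 ∨ k = 0 ∨ 1 ≤ k) with h | h | h
    · left; exact_mod_cast h
    · right; left; exact_mod_cast h
    · right; right; exact_mod_cast h
  rcases hx.pairingIn_highest hξ i with hn | hn | hn | hn | hn
  · exfalso
    rw [hn] at h h2 h3 h6
    push_cast at h h2 h3 h6
    have h7 : P.root' i x < 0 := lt_of_le_of_ne (by linarith) h7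
    have h6 : 0 < P.root' i x + P.root' ξ x :=
      lt_of_le_of_ne (by linarith) (fun h => h6 (by linarith))
    rcases hk with hk | hk | hk <;> nlinarith
  · exfalso
    rw [hn] at h
    push_cast at h
    nlinarith [sq_nonneg (P.root' i x - k)]
  · exfalso
    rw [hn] at h h2 h3 h6
    push_cast at h h2 h3 h6
    have h7 : 0 < P.root' i x := lt_of_le_of_ne (by linarith) h7.symm
    have h6 : P.root' i x - P.root' ξ x < 0 :=
      lt_of_le_of_ne (by linarith) (fun h => h6 (by linarith))
    rcases hk with hk | hk | hk <;> nlinarith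
  · obtain rfl := P.root.injective hn
    rw [hp, RootPairing.pairing_same, Int.cast_one] at h
    have hk1 : (k : ℝ) < 2 := by nlinarith
    have hk2 : (0 : ℝ) < k := by nlinarith
    have : k = 1 := by
      have : k < 2 := by exact_mod_cast hk1
      have : 0 < k := by exact_mod_cast hk2
      omega
    rw [this]
  · have hi : i = P.reflectionPerm ξ ξ := P.root.injective (by rw [hn]; simp)
    have hv : P.root' i x = -P.root' ξ x := by
      rw [hi, root'_reflectionPerm_apply, RootPairing.pairing_same]; ring
    have hpr : P.pairing i ξ = -2 := by
      rw [hi, RootPairing.pairing_reflectionPerm_self_left, RootPairing.pairing_same]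
    rw [hp, hpr, hv, Int.cast_one] at h
    have hk1 : (k : ℝ) < 0 := by nlinarith
    have hk2 : (-2 : ℝ) < k := by nlinarith
    have : k = -1 := by
      have : k < 0 := by exact_mod_cast hk1
      have : -2 < k := by exact_mod_cast hk2
      omega
    rw [this]
    exact affineReflection_of_root_eq_neg P hn 1

/-- All roots take values in $(-1,1)$ at both points, so $k=0$; and a simple reflection permutes the
positive roots other than its own. -/
theorem eq_of_separates_simple [Finite ι] [P.IsReduced] [P.IsRootSystem] {i j : ι} {k : ℤ}
    (hj : j ∈ b.support)
    (h : (P.root' i x - k) * (P.root' i (affineReflection P j 0 x) - k) < 0) :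
    affineReflection P i k = affineReflection P j 0 := by
  have h1 := hx.neg_le_root' hξ (P.reflectionPerm j i)
  have h2 := hx.root'_le hξ (P.reflectionPerm j i)
  have h3 := hx.highest_lt_one
  have h4 := hx.root'_le hξ i
  have h5 := hx.neg_le_root' hξ i
  rw [root'_affineReflection] at h
  simp only [Int.cast_zero, zero_mul, add_zero] at h
  have hk : k = 0 := by
    by_contra hk
    rcases lt_or_gt_of_ne hk with hk | hk
    · have : (k : ℝ) ≤ -1 := by exact_mod_cast (by omega : k ≤ -1)
      nlinarith
    · have : (1 : ℝ) ≤ k := by exact_mod_cast hk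
      nlinarith
  subst hk
  simp only [Int.cast_zero, sub_zero] at h
  let := P.indexNeg
  by_cases hpos : b.IsPos i
  · by_cases hij : i = j
    · rw [hij]
    · exact absurd h (mul_pos ((hx.isPos_iff).1 hpos)
        ((hx.isPos_iff).1 (hpos.reflectionPerm hj hij))).le.not_gt
  · have hneg := (RootPairing.Base.IsPos.neg_iff_not b i).2 hpos
    by_cases hij : -i = j
    · have hr : P.root i = -P.root j := by
        rw [← hij, RootPairing.indexNeg_neg]; simp
      simpa using affineReflection_of_root_eq_neg P hr 0
    · have h6 := (hx.isPos_iff).1 (hneg.reflectionPerm hj hij)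
      have h7 := (hx.isPos_iff).1 hneg
      rw [RootPairing.indexNeg_neg] at h6 h7
      rw [root'_reflectionPerm_apply, RootPairing.pairing_reflectionPerm_self_left] at h6
      rw [root'_reflectionPerm_apply, RootPairing.pairing_same] at h6 h7
      rw [root'_reflectionPerm_apply] at h
      nlinarith

end IsAlcovePoint

end Alcove

/-! ### Generation by simple reflections, and the geometric cocycle -/

section Generation

variable {ι M N : Type*} [AddCommGroup M] [Module ℝ M] [AddCommGroup N] [Module ℝ N]
  {P : RootPairing ι ℝ M N}

theorem affineReflection_conj_zero (i j : ι) :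
    affineReflection P i 0 * affineReflection P j 0 * (affineReflection P i 0)⁻¹ =
      affineReflection P (P.reflectionPerm i j) 0 := by
  rw [mul_inv_eq_iff_eq_mul]
  ext x
  simp only [affineEquiv_mul_apply]
  rw [affineReflection_apply P (P.reflectionPerm i j), root'_affineReflection,
    affineReflection_apply P j, affineReflection_apply P i 0,
    affineReflection_apply P i 0,
    RootPairing.reflectionPerm_self, RootPairing.coroot_reflectionPerm,
    RootPairing.coreflection_apply_coroot]
  simp only [map_sub, map_smul, RootPairing.root'_coroot_eq_pairing, smul_eq_mul, Int.cast_zero]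
  module

theorem affineReflection_conj_constVAdd (i : ι) (x : N) :
    affineReflection P i 0 * AffineEquiv.constVAdd ℝ N x * (affineReflection P i 0)⁻¹ =
      AffineEquiv.constVAdd ℝ N (P.coreflection i x) := by
  rw [mul_inv_eq_iff_eq_mul]
  ext y
  simp only [affineEquiv_mul_apply, AffineEquiv.constVAdd_apply, vadd_eq_add,
    affineReflection_apply, RootPairing.coreflection_apply, map_add]
  simp only [RootPairing.root', Int.cast_zero]
  module

/-- The translations in `H` form a Weyl-stable lattice `L` containing $\xi^\vee$. Reflecting
$\xi^\vee$ in a root whose pairing with it is $\pm1$ puts the coroot of that root into `L`, so the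
roots with coroot outside `L` are orthogonal to $\xi^\vee$. Their span is Weyl-stable; by
irreducibility it is zero or everything, and the latter would contain $\xi$. -/
theorem constVAdd_coroot_mem [Finite ι] [P.IsCrystallographic] [P.IsIrreducible]
    {b : P.Base} {ξ : ι} (hξ : IsHighestRoot b ξ) {x : N} (hx : IsAlcovePoint b ξ x)
    {H : Subgroup (N ≃ᵃ[ℝ] N)} (h0 : ∀ i, affineReflection P i 0 ∈ H)
    (h1 : affineReflection P ξ 1 ∈ H) (i : ι) :
    AffineEquiv.constVAdd ℝ N (P.coroot i) ∈ H := by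
  have hadd {x y : N} : AffineEquiv.constVAdd ℝ N (x + y) =
      AffineEquiv.constVAdd ℝ N x * AffineEquiv.constVAdd ℝ N y :=
    (AffineEquiv.constVAddHom ℝ N).map_mul (.ofAdd x) (.ofAdd y)
  have hneg {x : N} : AffineEquiv.constVAdd ℝ N (-x) = (AffineEquiv.constVAdd ℝ N x)⁻¹ :=
    (AffineEquiv.constVAddHom ℝ N).map_inv (.ofAdd x)
  let L : AddSubgroup N :=
    { carrier := {x | AffineEquiv.constVAdd ℝ N x ∈ H}
      zero_mem' := by
        rw [Set.mem_ofPred_eq, AffineEquiv.constVAdd_zero]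
        exact one_mem H
      add_mem' := fun hx hy => by
        simp only [Set.mem_ofPred_eq] at hx hy ⊢
        rw [hadd]; exact mul_mem hx hy
      neg_mem' := fun hx => by
        simp only [Set.mem_ofPred_eq] at hx ⊢
        rw [hneg]; exact inv_mem hx }
  have hL (x : N) : x ∈ L ↔ AffineEquiv.constVAdd ℝ N x ∈ H := Iff.rfl
  have hrefl (j : ι) (x : N) (hx : x ∈ L) : P.coreflection j x ∈ L := by
    rw [hL, ← affineReflection_conj_constVAdd]
    exact mul_mem (mul_mem (h0 j) hx) (inv_mem (h0 j))
  have hξL : P.coroot ξ ∈ L := by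
    have : affineReflection P ξ 1 =
        AffineEquiv.constVAdd ℝ N (P.coroot ξ) * affineReflection P ξ 0 := by
      simp [affineReflection, AffineEquiv.one_def]
    rw [hL, ← mul_inv_eq_iff_eq_mul.2 this]
    exact mul_mem h1 (inv_mem (h0 ξ))
  by_contra hi
  have horth (j : ι) (hj : P.coroot j ∉ L) : P.pairing j ξ = 0 := by
    have hp : ((P.pairingIn ℤ j ξ : ℤ) : ℝ) = P.pairing j ξ := by
      simpa using P.algebraMap_pairingIn ℤ j ξ
    have hrξ := hrefl j _ hξL
    rw [RootPairing.coreflection_apply_coroot] at hrξ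
    change P.coroot ξ - P.pairing j ξ • _ ∈ L at hrξ
    have hsub := sub_mem hξL hrξ
    rw [sub_sub_cancel] at hsub
    rcases hx.pairingIn_highest hξ j with h | h | h | h | h
    · rw [← hp, h] at hsub
      exact absurd (by simpa using hsub) hj
    · rw [← hp, h, Int.cast_zero]
    · rw [← hp, h] at hsub
      exact absurd (by simpa using hsub) hj
    · rw [P.root.injective h] at hj
      exact absurd hξL hj
    · have hj' : j = P.reflectionPerm ξ ξ := P.root.injective (by rw [h]; simp)
      rw [hj', RootPairing.coroot_reflectionPerm] at hj
      exact absurd (hrefl ξ _ hξL) hj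
  let q : Submodule ℝ M := Submodule.span ℝ (P.root '' {j | P.coroot j ∉ L})
  have hq : q = ⊤ := by
    refine RootPairing.IsIrreducible.eq_top_of_invtSubmodule_reflection (P := P) q
      (fun k => ?_) ?_
    · rw [Module.End.mem_invtSubmodule, Submodule.span_le]
      rintro _ ⟨j, hj, rfl⟩
      refine Submodule.subset_span ⟨P.reflectionPerm k j, fun hk => hj ?_, ?_⟩
      · rw [RootPairing.coroot_reflectionPerm] at hk
        simpa using hrefl k _ hk
      · exact P.root_reflectionPerm k j
    · rw [Submodule.ne_bot_iff]
      exact ⟨P.root i, Submodule.subset_span ⟨i, hi, rfl⟩, P.ne_zero i⟩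
  have hker : q ≤ LinearMap.ker (P.coroot' ξ) := by
    rw [Submodule.span_le]
    rintro _ ⟨j, hj, rfl⟩
    simpa using horth j hj
  have : P.root ξ ∈ LinearMap.ker (P.coroot' ξ) := hker (hq ▸ Submodule.mem_top)
  simp at this

theorem affineReflection_mem_closure [Finite ι] [P.IsRootSystem] [P.IsCrystallographic]
    [P.IsReduced] [P.IsIrreducible] {b : P.Base} {ξ : ι} (hξ : IsHighestRoot b ξ) {x : N}
    (hx : IsAlcovePoint b ξ x) {H : Subgroup (N ≃ᵃ[ℝ] N)}
    (h0 : ∀ i ∈ b.support, affineReflection P i 0 ∈ H)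
    (h1 : affineReflection P ξ 1 ∈ H) (i : ι) (k : ℤ) : affineReflection P i k ∈ H := by
  have h0' (i : ι) : affineReflection P i 0 ∈ H := by
    refine b.induction_reflect i (p := fun i => affineReflection P i 0 ∈ H) ?_ h0 ?_
    · intro i hi
      have := affineReflection_of_root_eq_neg P (i := i) (j := P.reflectionPerm i i) (by simp) 0
      rw [neg_zero] at this
      rwa [this]
    · intro i j hi hj
      rw [← affineReflection_conj_zero]
      exact mul_mem (mul_mem (h0 j hj) hi) (inv_mem (h0 j hj))
  have hk : affineReflection P i k =
      AffineEquiv.constVAdd ℝ N (P.coroot i) ^ k * affineReflection P i 0 := by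
    have : AffineEquiv.constVAdd ℝ N ((k : ℝ) • P.coroot i) =
        AffineEquiv.constVAdd ℝ N (P.coroot i) ^ k := by
      rw [← AffineEquiv.constVAdd_zsmul, Int.cast_smul_eq_zsmul]
    simp [affineReflection, this, AffineEquiv.one_def]
  rw [hk]
  exact mul_mem (zpow_mem (constVAdd_coroot_mem hξ hx h0' h1 i) k) (h0' i)

theorem closure_range_simpleReflection [Finite ι] [P.IsRootSystem] [P.IsCrystallographic]
    [P.IsReduced] [P.IsIrreducible] {b : P.Base} {ξ : ι} (hξ : IsHighestRoot b ξ) :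
    Subgroup.closure (Set.range (simpleReflection b ξ)) = ⊤ := by
  obtain ⟨x, hx⟩ := exists_isAlcovePoint b hξ
  rw [eq_top_iff]
  rintro ⟨g, hg⟩ -
  let H := (Subgroup.closure (Set.range (simpleReflection b ξ))).map (affineWeylGroup P).subtype
  have hsimple (j : Option b.support) : (simpleReflection b ξ j : N ≃ᵃ[ℝ] N) ∈ H :=
    ⟨_, Subgroup.subset_closure ⟨j, rfl⟩, rfl⟩
  have hle : affineWeylGroup P ≤ H := by
    refine (Subgroup.closure_le _).2 ?_
    rintro _ ⟨i, k, rfl⟩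
    exact affineReflection_mem_closure hξ hx (fun i hi => hsimple (some ⟨i, hi⟩))
      (hsimple none) i k
  obtain ⟨g', hg', rfl⟩ := hle hg
  exact hg'

theorem exists_simpleReflection_eq (b : P.Base) (ξ : ι) (j : Option b.support) :
    ∃ i k, (simpleReflection b ξ j : N ≃ᵃ[ℝ] N) = affineReflection P i k := by
  rcases j with _ | j
  · exact ⟨ξ, 1, rfl⟩
  · exact ⟨j, 0, rfl⟩

theorem separators_simpleReflection [Finite ι] [P.IsRootSystem] [P.IsCrystallographic]
    [P.IsReduced] {b : P.Base} {ξ : ι} (hξ : IsHighestRoot b ξ) {x : N}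
    (hx : IsAlcovePoint b ξ x) (j : Option b.support) :
    separators P x ((simpleReflection b ξ j : N ≃ᵃ[ℝ] N) x) = {simpleReflection b ξ j} := by
  ext t
  rw [Set.mem_singleton_iff]
  constructor
  · rintro ⟨i, k, ht, h⟩
    rw [Subtype.ext_iff, ht]
    rcases j with _ | j
    · exact hx.eq_of_separates_highest hξ h
    · exact hx.eq_of_separates_simple hξ j.2 h
  · rintro rfl
    obtain ⟨i, k, h⟩ := exists_simpleReflection_eq b ξ j
    refine ⟨i, k, h, ?_⟩
    have hreg := hx.isRegularPoint hξ i k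
    rw [h, root'_affineReflection, root'_reflectionPerm_apply, RootPairing.pairing_same]
    nlinarith [sq_pos_of_ne_zero hreg]

/-- The cocycle of the hyperplanes separating a point `x` of the fundamental alcove from `g x`. -/
def affineCocycle [Finite ι] [P.IsRootSystem] [P.IsCrystallographic] [P.IsReduced] {b : P.Base}
    {ξ : ι} (hξ : IsHighestRoot b ξ) {x : N} (hx : IsAlcovePoint b ξ x) :
    ReflectionCocycle (simpleReflection b ξ) where
  sep g := separators P x ((g : N ≃ᵃ[ℝ] N) x)
  gen_mul_self j := by
    obtain ⟨i, k, h⟩ := exists_simpleReflection_eq b ξ j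
    rw [Subtype.ext_iff, Subgroup.coe_mul, h, affineReflection_mul_self, Subgroup.coe_one]
  mem_mul_iff g h t := by
    have hreg := hx.isRegularPoint hξ
    -- The path from `x` to `g h x` is broken at `g x`; its second half is the image under `g` of
    -- the path from `x` to `h x`.
    rw [Subgroup.coe_mul, affineEquiv_mul_apply, mem_separators_trans_iff P hreg (hreg.apply P g)
      ((hreg.apply P h).apply P g)]
    refine iff_of_eq (congrArg _ (propext ?_))
    have := conj_mem_separators_iff P g (t := g⁻¹ * t * g) (x := x) (y := (h : N ≃ᵃ[ℝ] N) x)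
    simpa [mul_assoc] using this
  sep_gen := separators_simpleReflection hξ hx

end Generation

/-! ### Periodic infinite words and their inversion sets -/

section InfiniteWords

variable {B G : Type*} [Group G] {s : B → G}

theorem initialWord_add (a : ℕ → B) (k m : ℕ) :
    initialWord a (k + m) = initialWord a k ++ initialWord (fun x => a (k + x)) m := by
  simp [initialWord, List.range_add, Function.comp_def]

theorem initialWord_periodic {a : ℕ → B} {L : List B} (hL : 0 < L.length)
    (ha : ∀ k, a k = L[k % L.length]'(Nat.mod_lt k hL)) (n : ℕ) :
    initialWord a ((n + 1) * L.length) = initialWord a (n * L.length) ++ L := by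
  rw [Nat.succ_mul, initialWord_add]
  congr 1
  refine List.ext_getElem (by simp [initialWord]) fun k h1 h2 => ?_
  simp [initialWord, ha, Nat.mod_eq_of_lt h2]

theorem wordProd_initialWord_periodic {a : ℕ → B} {L : List B} (hL : 0 < L.length)
    (ha : ∀ k, a k = L[k % L.length]'(Nat.mod_lt k hL)) (n : ℕ) :
    wordProd s (initialWord a (n * L.length)) = wordProd s L ^ n := by
  induction n with
  | zero => simp [initialWord]
  | succ n ih => rw [initialWord_periodic hL ha, wordProd_append, ih, pow_succ]

theorem inversions_initialWord_mono (a : ℕ → B) {k m : ℕ} (h : k ≤ m) :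
    inversions s (initialWord a k) ⊆ inversions s (initialWord a m) := by
  obtain ⟨d, rfl⟩ := Nat.exists_eq_add_of_le h
  intro t
  rw [mem_inversions_iff, mem_inversions_iff, initialWord_add, inversionList_append]
  exact fun h => List.mem_append_left _ h

namespace ReflectionCocycle

variable (N : ReflectionCocycle s)

include N

theorem inv_eq_of_periodic (a : InfiniteReducedWord s) {L : List B} (hL : 0 < L.length)
    (ha : ∀ k, a.letter k = L[k % L.length]'(Nat.mod_lt k hL)) :
    a.inv = ⋃ n : ℕ, N.sep (wordProd s L ^ n) := by
  have key (n : ℕ) : N.sep (wordProd s L ^ n) =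
      inversions s (initialWord a.letter (n * L.length)) := by
    rw [N.inversions_eq (a.reduced _), wordProd_initialWord_periodic hL ha]
  simp only [key, InfiniteReducedWord.inv]
  refine subset_antisymm (Set.iUnion_subset fun k => ?_)
    (Set.iUnion_subset fun n => Set.subset_iUnion_of_subset _ subset_rfl)
  exact Set.subset_iUnion_of_subset k
    (inversions_initialWord_mono _ (Nat.le_mul_of_pos_right k hL))

theorem exists_infiniteReducedWord_periodic {L : List B} (hL : 0 < L.length)
    (hred : IsReducedWord s L)
    (hdisj : ∀ n : ℕ, ∀ t ∈ N.sep (wordProd s L ^ n),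
      (wordProd s L ^ n)⁻¹ * t * wordProd s L ^ n ∉ N.sep (wordProd s L)) :
    ∃ a : InfiniteReducedWord s, ∀ k, a.letter k = L[k % L.length]'(Nat.mod_lt k hL) := by
  let a (k : ℕ) : B := L[k % L.length]'(Nat.mod_lt k hL)
  have hmul (n : ℕ) : IsReducedWord s (initialWord a (n * L.length)) := by
    induction n with
    | zero => simp [initialWord, IsReducedWord]
    | succ n ih =>
      rw [initialWord_periodic hL (fun k => rfl), N.isReducedWord_append]
      refine ⟨ih, hred, ?_⟩
      rw [wordProd_initialWord_periodic hL (fun k => rfl)]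
      exact hdisj n
  refine ⟨⟨a, fun k => ?_⟩, fun k => rfl⟩
  -- The prefix of length `k` is a left factor of the prefix of length `k * L.length`, which is
  -- reduced.
  have h := hmul k
  obtain ⟨d, hd⟩ := Nat.exists_eq_add_of_le (Nat.le_mul_of_pos_right k hL)
  rw [hd, initialWord_add, N.isReducedWord_append] at h
  exact h.1

/-- The inversions of the braid factor are all reflections of its dihedral group, and the word `p`
preceding it conjugates them into the inversion set. -/
theorem exists_dihedral_subset_inv {a : InfiniteReducedWord s} (ha : ¬ a.IsFullyCommutative) :
    ∃ (g : G) (i j : B), 3 ≤ orderOf (s i * s j) ∧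
      ∀ t ∈ dihedralReflections s i j, g * t * g⁻¹ ∈ a.inv := by
  simp only [InfiniteReducedWord.IsFullyCommutative, IsFullyCommutativeElt] at ha
  push Not at ha
  obtain ⟨k, L, hL, hLa, i, j, hm, p, q, rfl⟩ := ha
  refine ⟨wordProd s p, i, j, hm, fun t ht => ?_⟩
  rw [← mem_inversionList_alternatingWord s N.gen_mul_self (by omega)] at ht
  refine Set.mem_iUnion.2 ⟨k, ?_⟩
  rw [N.inversions_eq (a.reduced k), ← hLa, N.mem_sep_iff hL, inversionList_append,
    inversionList_append]
  exact List.mem_append_left _ (List.mem_append_right _ (List.mem_map.2 ⟨t, ht, rfl⟩))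

end ReflectionCocycle

end InfiniteWords

/-! ### Transverse dihedral subgroups and powers of a translation -/

section Transverse

variable {ι M N : Type*} [AddCommGroup M] [Module ℝ M] [AddCommGroup N] [Module ℝ N]
  {P : RootPairing ι ℝ M N}

/-- `t` is a reflection in a hyperplane that is crossed from `y` in the direction `l`. -/
def IsBehind (l : P.corootSpan ℤ) (t : affineWeylGroup P) (y : N) : Prop :=
  ∃ (i : ι) (k : ℤ), (t : N ≃ᵃ[ℝ] N) = affineReflection P i k ∧
    P.root' i (l : N) * (P.root' i y - k) < 0

theorem isBehind_iff {l : P.corootSpan ℤ} {t : affineWeylGroup P} {i : ι} {k : ℤ}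
    (ht : (t : N ≃ᵃ[ℝ] N) = affineReflection P i k) (y : N) :
    IsBehind l t y ↔ P.root' i (l : N) * (P.root' i y - k) < 0 := by
  refine ⟨?_, fun h => ⟨i, k, ht, h⟩⟩
  rintro ⟨j, m, htj, h⟩
  obtain ⟨c, hc, hcx⟩ := affineReflection_eq_iff_exists P (ht.symm.trans htj)
  have h1 := hcx (l : N)
  have h2 := hcx 0
  rw [map_zero, map_zero] at h2
  have h3 : P.root' i (l : N) = c * P.root' j (l : N) := by linarith
  rw [hcx, h3]
  nlinarith [mul_pos_of_neg_of_neg h (neg_neg_of_pos (sq_pos_of_ne_zero hc))]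

/-- An element commuting with the translation has linear part fixing `l`, so it preserves the
direction of crossing. -/
theorem IsBehind.conj [P.IsCrystallographic] {l : P.corootSpan ℤ} {t h : affineWeylGroup P} {y : N}
    (hy : IsBehind l t y) (hh : Commute h (translation P l)) :
    IsBehind l (h * t * h⁻¹) ((h : N ≃ᵃ[ℝ] N) y) := by
  obtain ⟨i, k, ht, hy⟩ := hy
  obtain ⟨j, m, h1, h2⟩ := exists_affineReflection_conj P (h⁻¹).2 i k
  refine ⟨j, m, by simpa [ht] using h2, ?_⟩
  have h3 := h1 ((h : N ≃ᵃ[ℝ] N) y)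
  have h4 := h1 (l + (h : N ≃ᵃ[ℝ] N) y)
  have h5 : (h : N ≃ᵃ[ℝ] N) (l + y) = l + (h : N ≃ᵃ[ℝ] N) y :=
    DFunLike.congr_fun (congrArg Subtype.val hh.eq) y
  rw [← h5] at h4
  simp only [Subgroup.coe_inv, affineEquiv_inv_apply_self] at h3 h4
  rw [h5, map_add, map_add] at h4
  have h6 : P.root' j (l : N) = P.root' i (l : N) := by linarith
  rwa [h6, ← h3]

theorem eventually_lt_mul_sq (r : ℝ) {c : ℝ} (hc : c ≠ 0) :
    ∀ᶠ n : ℕ in Filter.atTop, r < n * c ^ 2 :=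
  (tendsto_natCast_atTop_atTop.atTop_mul_const (sq_pos_of_ne_zero hc)).eventually_gt_atTop r

theorem translation_pow_inv_apply (l : P.corootSpan ℤ) (n : ℕ) (x : N) :
    ((translation P l ^ n : affineWeylGroup P)⁻¹ : N ≃ᵃ[ℝ] N) x = x - (n : ℝ) • (l : N) := by
  apply ((translation P l ^ n : affineWeylGroup P) : N ≃ᵃ[ℝ] N).injective
  rw [← affineEquiv_mul_apply, mul_inv_cancel, translation_pow_apply]
  change x = _
  module

theorem exists_minimal {α : Type*} {p : α → Prop} (f : α → ℕ) (h : ∃ a, p a) :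
    ∃ a, p a ∧ ∀ b, p b → f a ≤ f b := by
  obtain ⟨a, ha, hmin⟩ := (InvImage.wf f Nat.lt_wfRel.wf).has_min {a | p a} h
  exact ⟨a, ha, fun b hb => not_lt.1 (hmin b hb)⟩

section

variable [Finite ι] [P.IsRootSystem] [P.IsCrystallographic] [P.IsReduced]
  {b : P.Base} {ξ : ι} (hξ : IsHighestRoot b ξ) {x : N} (hx : IsAlcovePoint b ξ x)

include hξ hx

theorem not_commute_of_mem_sep_pow {l : P.corootSpan ℤ} {n : ℕ} {t : affineWeylGroup P}
    (ht : t ∈ (affineCocycle hξ hx).sep (translation P l ^ n)) :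
    ¬ Commute t (translation P l) := by
  obtain ⟨i, k, ht, h⟩ := ht
  rw [commute_translation_iff ht]
  intro h0
  rw [translation_pow_apply, map_add, map_smul, h0, smul_zero, zero_add] at h
  nlinarith [sq_nonneg (P.root' i x - k)]

/-- Every root is monotone along $x,\ x+n\lambda,\ x+(n+1)\lambda$, so no hyperplane is crossed in
both steps. -/
theorem notMem_sep_translation (l : P.corootSpan ℤ) (n : ℕ) {t : affineWeylGroup P}
    (ht : t ∈ (affineCocycle hξ hx).sep (translation P l ^ n)) :
    (translation P l ^ n)⁻¹ * t * translation P l ^ n ∉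
      (affineCocycle hξ hx).sep (translation P l) := by
  intro h
  have h := conj_mem_separators P (translation P l ^ n) h
  rw [translation_pow_apply, translation_pow_apply, translation_apply] at h
  obtain ⟨i, k, hti, ht⟩ := ht
  rw [mem_separators_iff P (by simpa [mul_assoc] using hti)] at h
  rw [translation_pow_apply] at ht
  simp only [map_add, map_smul, smul_eq_mul] at h ht
  have h1 : P.root' i (l : N) * (n * P.root' i (l : N) + P.root' i x - k) < 0 := by
    nlinarith [sq_nonneg (n * P.root' i (l : N) + P.root' i x - k)]
  nlinarith [sq_nonneg (n * P.root' i (l : N) + P.root' i x - k),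
    mul_nonneg (Nat.cast_nonneg (α := ℝ) n) (neg_nonneg.2 h1.le)]

theorem mem_sep_alternatingWord {i j : Option b.support}
    (hm : 0 < orderOf (simpleReflection b ξ i * simpleReflection b ξ j)) (t : affineWeylGroup P) :
    t ∈ (affineCocycle hξ hx).sep (wordProd (simpleReflection b ξ)
        (CoxeterSystem.alternatingWord i j
          (orderOf (simpleReflection b ξ i * simpleReflection b ξ j)))) ↔
      t ∈ dihedralReflections (simpleReflection b ξ) i j := by
  have hsq := (affineCocycle hξ hx).gen_mul_self
  rw [(affineCocycle hξ hx).mem_sep_iff_of_nodup (nodup_inversionList_alternatingWord _ hsq i j),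
    mem_inversionList_alternatingWord _ hsq hm]

variable [P.IsIrreducible]

theorem exists_isBehind_dihedral {l : P.corootSpan ℤ} {g : affineWeylGroup P}
    {i j : Option b.support}
    (hm : 0 < orderOf (simpleReflection b ξ i * simpleReflection b ξ j))
    (hg : ∀ t ∈ dihedralReflections (simpleReflection b ξ) i j,
      ¬ Commute (g * t * g⁻¹) (translation P l)) :
    ∃ g' : affineWeylGroup P, ∀ t ∈ dihedralReflections (simpleReflection b ξ) i j,
      IsBehind l (g' * t * g'⁻¹) ((g' : N ≃ᵃ[ℝ] N) x) := by
  set s := simpleReflection b ξ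
  have hsq := (affineCocycle hξ hx).gen_mul_self
  have hreg := hx.isRegularPoint hξ
  have hfin : (dihedralReflections s i j).Finite := by
    refine (List.finite_toSet (inversionList s (CoxeterSystem.alternatingWord i j
      (orderOf (s i * s j))))).subset fun t ht => ?_
    exact (mem_inversionList_alternatingWord s hsq hm t).2 ht
  -- Far enough back along `-l`, the point has all the finitely many transverse hyperplanes ahead of
  -- it.
  obtain ⟨m, hbehind⟩ : ∃ m : ℕ, ∀ t ∈ dihedralReflections s i j, IsBehind l (g * t * g⁻¹)
      (((translation P l ^ m : affineWeylGroup P)⁻¹ : N ≃ᵃ[ℝ] N) x) := by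
    refine Filter.Eventually.exists (f := Filter.atTop)
      ((Filter.eventually_all_finite hfin).2 fun t ht => ?_)
    have hsep := conj_mem_separators P g ((mem_sep_alternatingWord hξ hx hm t).2 ht)
    obtain ⟨β, k, hβ, -⟩ := hsep
    have hne : P.root' β (l : N) ≠ 0 := fun h0 => hg t ht ((commute_translation_iff hβ l).2 h0)
    filter_upwards [eventually_lt_mul_sq (P.root' β (l : N) * (P.root' β x - k)) hne] with n hn
    rw [isBehind_iff hβ, translation_pow_inv_apply, map_sub, map_smul, smul_eq_mul]
    linarith
  -- Among the alcoves `g u x`, take one nearest to the translate of `x` by `-m • l`. A hyperplane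
  -- of the conjugated dihedral group separating the two could be reflected away by strong exchange,
  -- replacing `u` by `r * u`; hence both points lie on the same side of all of them.
  obtain ⟨u, hu, hmin⟩ := exists_minimal (p := (· ∈ Subgroup.closure {s i, s j}))
    (fun u => ((affineCocycle hξ hx).sep (translation P l ^ m * g * u)).ncard) ⟨1, one_mem _⟩
  refine ⟨g * u, fun t ht => ?_⟩
  have ht' := conj_mem_dihedralReflections s hsq hu ht
  have hconj : g * u * t * (g * u)⁻¹ = g * (u * t * u⁻¹) * g⁻¹ := by simp [mul_assoc]
  rw [hconj]
  generalize u * t * u⁻¹ = r at ht'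
  obtain ⟨β, k, hβ, hneg⟩ := hbehind r ht'
  refine ⟨β, k, hβ, ?_⟩
  have hnot : g * r * g⁻¹ ∉ separators P
      (((translation P l ^ m : affineWeylGroup P)⁻¹ : N ≃ᵃ[ℝ] N) x)
      (((g * u : affineWeylGroup P) : N ≃ᵃ[ℝ] N) x) := by
    intro h
    have h := conj_mem_separators P (translation P l ^ m) h
    rw [← affineEquiv_mul_apply, mul_inv_cancel] at h
    have hlt := (affineCocycle hξ hx).ncard_sep_mul_lt (closure_range_simpleReflection hξ)
      (g := translation P l ^ m * g * u)
      (t := translation P l ^ m * (g * r * g⁻¹) * (translation P l ^ m)⁻¹)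
      (by rw [mul_assoc (translation P l ^ m) g u]; exact h)
    have hle := hmin (r * u) (mul_mem (mem_closure_of_mem_dihedralReflections s ht') hu)
    refine hlt.not_ge (hle.trans_eq ?_)
    simp [mul_assoc]
  rw [mem_separators_iff P hβ, not_lt] at hnot
  have h1 := hreg.apply P (g * u) β k
  set z := P.root' β (((translation P l ^ m : affineWeylGroup P)⁻¹ : N ≃ᵃ[ℝ] N) x) - k
  set w := P.root' β (((g * u : affineWeylGroup P) : N ≃ᵃ[ℝ] N) x) - k
  have hz : z ≠ 0 := by rintro h; simp [h] at hneg
  have hzw : 0 < z * w := lt_of_le_of_ne hnot (mul_ne_zero hz h1).symm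
  by_contra hcon
  nlinarith [mul_nonneg (not_lt.1 hcon) hzw.le, mul_pos_of_neg_of_neg hneg hneg,
    mul_neg_of_neg_of_pos hneg hzw, sq_pos_of_ne_zero h1, sq_pos_of_ne_zero hz]

theorem exists_isBehind_dihedral_and_notMem {l : P.corootSpan ℤ} {g : affineWeylGroup P}
    {i j : Option b.support}
    (hm : 0 < orderOf (simpleReflection b ξ i * simpleReflection b ξ j))
    (hg : ∀ t ∈ dihedralReflections (simpleReflection b ξ) i j,
      ¬ Commute (g * t * g⁻¹) (translation P l)) :
    ∃ g' : affineWeylGroup P, (∀ t ∈ dihedralReflections (simpleReflection b ξ) i j,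
      IsBehind l (g' * t * g'⁻¹) ((g' : N ≃ᵃ[ℝ] N) x)) ∧
      ∀ t, Commute t (translation P l) → t ∉ (affineCocycle hξ hx).sep g' := by
  obtain ⟨g, hg⟩ := exists_isBehind_dihedral hξ hx hm hg
  -- Left multiplication by the centralizer of the translation keeps the hyperplanes ahead; choosing
  -- `h` of minimal length for `h * g` removes, by strong exchange, every separating hyperplane
  -- parallel to `l`.
  obtain ⟨h, hh, hmin⟩ := exists_minimal (p := (Commute · (translation P l)))
    (fun h => ((affineCocycle hξ hx).sep (h * g)).ncard) ⟨1, Commute.one_left _⟩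
  refine ⟨h * g, fun t ht => ?_, fun t ht hsep => ?_⟩
  · have := (hg t ht).conj hh
    simpa [mul_assoc] using this
  · have hlt := (affineCocycle hξ hx).ncard_sep_mul_lt (closure_range_simpleReflection hξ) hsep
    rw [← mul_assoc] at hlt
    exact hlt.not_ge (hmin (t * h) (ht.mul_left hh))

theorem HasTransverseDihedral.exists_not_isFullyCommutativeElt {l : P.corootSpan ℤ}
    (h : HasTransverseDihedral (simpleReflection b ξ) (translation P l)) :
    ∃ n : ℕ, ¬ IsFullyCommutativeElt (simpleReflection b ξ) (translation P l ^ n) := by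
  obtain ⟨g, i, j, hm, hg⟩ := h
  have hm0 : 0 < orderOf (simpleReflection b ξ i * simpleReflection b ξ j) := by omega
  obtain ⟨g, hbehind, hsep⟩ := exists_isBehind_dihedral_and_notMem hξ hx hm0 hg
  have hdih := mem_sep_alternatingWord hξ hx hm0
  set s := simpleReflection b ξ
  set T := translation P l
  set C := affineCocycle hξ hx
  set A := CoxeterSystem.alternatingWord i j (orderOf (s i * s j)) with hA
  set v := wordProd s A
  -- For roots not vanishing on `l`, signed to increase along `l`, the first two bounds make the
  -- values at $x,\ t^ngx,\ t^{2n}x$ increase; the third does so for $t^ngvx,\ t^{2n}x$.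
  obtain ⟨n, hn⟩ : ∃ n : ℕ, ∀ β, P.root' β (l : N) ≠ 0 →
      P.root' β (l : N) * (P.root' β x - P.root' β ((g : N ≃ᵃ[ℝ] N) x)) <
        n * P.root' β (l : N) ^ 2 ∧
      P.root' β (l : N) * (P.root' β ((g : N ≃ᵃ[ℝ] N) x) - P.root' β x) <
        n * P.root' β (l : N) ^ 2 ∧
      P.root' β (l : N) * (P.root' β (((g * v : affineWeylGroup P) : N ≃ᵃ[ℝ] N) x) - P.root' β x) <
        n * P.root' β (l : N) ^ 2 := by
    refine Filter.Eventually.exists (f := Filter.atTop) (Filter.eventually_all.2 fun β => ?_)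
    by_cases h : P.root' β (l : N) = 0
    · exact Filter.Eventually.of_forall fun n hn => absurd h hn
    · filter_upwards [eventually_lt_mul_sq _ h, eventually_lt_mul_sq _ h,
        eventually_lt_mul_sq _ h] with n h1 h2 h3 _ using ⟨h1, h2, h3⟩
  have hgen := closure_range_simpleReflection hξ
  obtain ⟨L₁, hL₁, hL₁p⟩ := exists_isReducedWord s C.gen_mul_self hgen (T ^ n * g)
  obtain ⟨L₃, hL₃, hL₃p⟩ := exists_isReducedWord s C.gen_mul_self hgen ((g * v)⁻¹ * T ^ n)
  have hAred : IsReducedWord s A :=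
    C.isReducedWord_iff.2 (nodup_inversionList_alternatingWord s C.gen_mul_self i j)
  have happ (y : N) : ((T ^ n : affineWeylGroup P) : N ≃ᵃ[ℝ] N) y = (n : ℝ) • (l : N) + y :=
    translation_pow_apply l n y
  -- A dihedral hyperplane is ahead of $t^ngx$, so crossing it on the way to $t^ngvx$ goes forward,
  -- and the third bound prevents a return.
  have hinner : ∀ t ∈ C.sep v, v⁻¹ * t * v ∉ C.sep ((g * v)⁻¹ * T ^ n) := by
    intro t ht ht'
    have hb := (hbehind t ((hdih t).1 ht)).conj ((Commute.refl T).pow_left n)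
    have h1 := conj_mem_separators P (T ^ n * g) ht
    have h2 := conj_mem_separators P (T ^ n * g * v) ht'
    have hc1 : T ^ n * (g * t * g⁻¹) * (T ^ n)⁻¹ = T ^ n * g * t * (T ^ n * g)⁻¹ := by
      simp [mul_assoc]
    have hc2 : T ^ n * g * v * (v⁻¹ * t * v) * (T ^ n * g * v)⁻¹ =
        T ^ n * g * t * (T ^ n * g)⁻¹ := by
      simp [mul_assoc]
    rw [hc1] at hb
    rw [hc2, ← affineEquiv_mul_apply, ← Subgroup.coe_mul,
      show T ^ n * g * v * ((g * v)⁻¹ * T ^ n) = T ^ n * T ^ n by simp [mul_assoc],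
      mul_assoc (T ^ n) g v] at h2
    rw [← affineEquiv_mul_apply, ← Subgroup.coe_mul, mul_assoc (T ^ n) g v] at h1
    obtain ⟨β, k, hβ, hb⟩ := hb
    rw [mem_separators_iff P hβ] at h1 h2
    simp only [Subgroup.coe_mul, affineEquiv_mul_apply, happ, map_add, map_smul, smul_eq_mul]
      at h1 h2 hb
    have hne : P.root' β (l : N) ≠ 0 := by intro h0; simp [h0] at hb
    obtain ⟨-, -, h3⟩ := hn β hne
    simp only [Subgroup.coe_mul, affineEquiv_mul_apply] at h3
    set c := P.root' β (l : N)
    have h4 := mul_neg_iff.1 hb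
    have h5 := mul_neg_iff.1 h1
    have h6 := mul_neg_iff.1 h2
    rcases h4 with ⟨h4, h4'⟩ | ⟨h4, h4'⟩ <;> rcases h5 with ⟨h5, h5'⟩ | ⟨h5, h5'⟩ <;>
      rcases h6 with ⟨h6, h6'⟩ | ⟨h6, h6'⟩ <;> first | linarith | nlinarith
  have houter : ∀ t ∈ C.sep (T ^ n * g), (T ^ n * g)⁻¹ * t * (T ^ n * g) ∉
      C.sep (v * ((g * v)⁻¹ * T ^ n)) := by
    intro t h1 ht'
    have h2 := conj_mem_separators P (T ^ n * g) ht'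
    have hc2 : T ^ n * g * ((T ^ n * g)⁻¹ * t * (T ^ n * g)) * (T ^ n * g)⁻¹ = t := by
      simp [mul_assoc]
    rw [hc2, ← affineEquiv_mul_apply, ← Subgroup.coe_mul,
      show T ^ n * g * (v * ((g * v)⁻¹ * T ^ n)) = T ^ n * T ^ n by simp [mul_assoc]] at h2
    obtain ⟨β, k, hβ, h1⟩ := h1
    rw [mem_separators_iff P hβ] at h2
    simp only [Subgroup.coe_mul, affineEquiv_mul_apply, happ, map_add, map_smul, smul_eq_mul]
      at h1 h2
    -- For a hyperplane parallel to `l` the translations drop out and it would separate `x` from `g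
    -- x`, which the choice of `g` excludes.
    by_cases hne : P.root' β (l : N) = 0
    · refine hsep t ((commute_translation_iff hβ l).2 hne) ⟨β, k, hβ, ?_⟩
      simpa [hne] using h1
    · obtain ⟨h3, h4, -⟩ := hn β hne
      set c := P.root' β (l : N)
      have h5 := mul_neg_iff.1 h1
      have h6 := mul_neg_iff.1 h2
      rcases lt_or_gt_of_ne hne with h7 | h7 <;> rcases h5 with ⟨h5, h5'⟩ | ⟨h5, h5'⟩ <;>
        rcases h6 with ⟨h6, h6'⟩ | ⟨h6, h6'⟩ <;> first | linarith | nlinarith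
  refine ⟨n + n, fun hfc => ?_⟩
  refine hfc (L₁ ++ (A ++ L₃)) ?_ ?_ i j hm ⟨L₁, L₃, by rw [hA, List.append_assoc]⟩
  · rw [C.isReducedWord_append, C.isReducedWord_append, wordProd_append, hL₁p, hL₃p]
    exact ⟨hL₁, ⟨hAred, hL₃, hinner⟩, houter⟩
  · rw [wordProd_append, wordProd_append, hL₁p, hL₃p, pow_add]
    change T ^ n * g * (v * _) = _
    simp [mul_assoc]

end

variable [Finite ι] [P.IsRootSystem] [P.IsCrystallographic] [P.IsReduced] [P.IsIrreducible]
  {b : P.Base} {ξ : ι}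

theorem infinitePowerIsFullyCommutative_translation_iff (hξ : IsHighestRoot b ξ)
    (l : P.corootSpan ℤ) :
    InfinitePowerIsFullyCommutative (simpleReflection b ξ) (translation P l) ↔
      translation P l ≠ 1 ∧
        ¬ HasTransverseDihedral (simpleReflection b ξ) (translation P l) := by
  obtain ⟨x, hx⟩ := exists_isAlcovePoint b hξ
  let C := affineCocycle hξ hx
  constructor
  · rintro ⟨_, ⟨L, hL, a, hred, hLT, ha, rfl⟩, hfc⟩
    refine ⟨fun h => ?_, fun h => ?_⟩
    · have := hred [] (by rw [hLT, h, wordProd_nil])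
      simp only [List.length_nil] at this
      omega
    · obtain ⟨n, hn⟩ := h.exists_not_isFullyCommutativeElt hξ hx
      refine hn ?_
      rw [← hLT, ← wordProd_initialWord_periodic hL ha]
      exact hfc a rfl _
  · rintro ⟨h1, h⟩
    obtain ⟨L, hred, hLT⟩ := exists_isReducedWord (simpleReflection b ξ) C.gen_mul_self
      (closure_range_simpleReflection hξ) (translation P l)
    have hL : 0 < L.length := by
      rw [List.length_pos_iff]
      rintro rfl
      exact h1 hLT.symm
    obtain ⟨a, ha⟩ := C.exists_infiniteReducedWord_periodic hL hred (by
      rw [hLT]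
      exact fun n t ht => notMem_sep_translation hξ hx l n ht)
    refine ⟨a.cls, ⟨L, hL, a, hred, hLT, ha, rfl⟩, fun a' ha' => ?_⟩
    by_contra hfc
    obtain ⟨g, i, j, hm, hsub⟩ := C.exists_dihedral_subset_inv hfc
    refine h ⟨g, i, j, hm, fun t ht => ?_⟩
    -- Any word in the class may violate full commutativity, but its inversion set is that of the
    -- periodic word.
    have hinv : a'.inv = a.inv := Quotient.exact ha'
    have hmem := hsub t ht
    rw [hinv, C.inv_eq_of_periodic a hL ha, hLT, Set.mem_iUnion] at hmem
    obtain ⟨n, hmem⟩ := hmem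
    exact not_commute_of_mem_sep_pow hξ hx hmem

theorem InfinitePowerIsFullyCommutative.conj_translation (hξ : IsHighestRoot b ξ)
    {l l' : P.corootSpan ℤ} {g : affineWeylGroup P}
    (hl : translation P l' = g * translation P l * g⁻¹) :
    InfinitePowerIsFullyCommutative (simpleReflection b ξ) (translation P l) ↔
      InfinitePowerIsFullyCommutative (simpleReflection b ξ) (translation P l') := by
  have hl' : translation P l = g⁻¹ * translation P l' * g⁻¹⁻¹ := by simp [hl, mul_assoc]
  rw [infinitePowerIsFullyCommutative_translation_iff hξ,
    infinitePowerIsFullyCommutative_translation_iff hξ]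
  refine and_congr (not_congr ?_) (not_congr ⟨fun h => hl ▸ h.conj _ g, fun h => ?_⟩)
  · rw [hl, conj_eq_one_iff]
  · rw [hl']; exact h.conj _ g⁻¹

end Transverse

end LimitWeak

theorem lemma5p3 {ι M N : Type*} [Finite ι] [AddCommGroup M] [Module ℝ M]
    [AddCommGroup N] [Module ℝ N] (P : RootPairing ι ℝ M N) [P.IsRootSystem]
    [P.IsCrystallographic] [P.IsReduced] [P.IsIrreducible]
    (b : P.Base) (ξ : ι) (hξ : LimitWeak.IsHighestRoot b ξ) (l : P.corootSpan ℤ)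
    (w : LimitWeak.weylGroup P) :
    LimitWeak.InfinitePowerIsFullyCommutative (LimitWeak.simpleReflection b ξ)
        (LimitWeak.translation P l) ↔
      LimitWeak.InfinitePowerIsFullyCommutative (LimitWeak.simpleReflection b ξ)
        (LimitWeak.translation P (LimitWeak.weylAct P w l)) := by
  obtain ⟨g, hg⟩ := LimitWeak.translation_weylAct w l
  exact LimitWeak.InfinitePowerIsFullyCommutative.conj_translation hξ hg
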